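/- Let $(M,g)$ be a closed (compact, without boundary) smooth Riemannian manifold and let $f:M\to\mathbb{R}$ be a $C^2$ function all of whose critical points are isolated. Let $\varphi=\{\varphi_t\}_{t\in\mathbb{R}}$ be the downward gradient flow, $\frac{d}{dt}\varphi_t=-(\nabla f)\circ\varphi_t$, $\varphi_0=\mathrm{id}$, and for a critical point $x$ let $$W^u(x)=\{p\in M: \lim_{t\to-\infty}\varphi_t p=x\},\qquad W^s(x)=\{p\in M: \lim_{t\to\infty}\varphi_t p=x\}$$ be its unstable and stable manifolds. A subset $A\subset M$ is *nullhomotopic to* $m\in M$ if the inclusion $A\hookrightarrow M$ is homotopic to the constant map with value $m$. It is *ambient nullhomotopic to* $m$ if there is a homotopy $h:[0,1]\times M\to M$ such that $h_0=\mathrm{id}_M$, each $h_t:M\to M$ is continuously differentiable, and $h_1(a)=m$ for all $a\in A$. Then $f$ has only finitely many critical points, say $x_1,\dots,x_\ell$ (pairwise distinct), and the following hold. (i) There is an open cover $\{\mathcal{W}_i\}_{i=1}^\ell$ of $M$ such that each $\mathcal{W}_i$ contains $W^u(x_i)$ and is nullhomotopic to $x_i$. (ii) For any given compact sets $K_i\subset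 W^u(x_i)$, $i=1,\dots,\ell$, there is an open cover $\{\mathcal{U}_i\}_{i=1}^\ell$ of $M$ such that each $\mathcal{U}_i$ contains $K_i$ and is ambient nullhomotopic to $x_i$. Moreover, the covers in (i) and in (ii) can be chosen such that $\mathcal{W}_i\cap\mathcal{W}_j=\emptyset$ and $\mathcal{U}_i\cap\mathcal{U}_j=\emptyset$ whenever $i\ne j$ and $f(x_i)=f(x_j)$. The same statements, (i) and (ii) with the disjointness property, hold with the stable manifolds $W^s(x_i)$ in place of the unstable manifolds $W^u(x_i)$ (for covers $\{\mathcal{W}_i^*\}$ and $\{\mathcal{U}_i^*\}$). -/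

import Mathlib

open Set Filter Topology
open scoped Manifold ContDiff

noncomputable section

namespace GradientCovers

/-- A smooth Riemannian metric on the smooth `n`-dimensional manifold `M`. -/
abbrev SmoothMetric (n : ℕ) (M : Type*) [TopologicalSpace M]
    [ChartedSpace (EuclideanSpace ℝ (Fin n)) M] [IsManifold (𝓡 n) ∞ M] :=
  Bundle.ContMDiffRiemannianMetric (𝓡 n) ∞ (EuclideanSpace ℝ (Fin n))
    (fun x : M => TangentSpace (𝓡 n) x)

section

variable {n : ℕ} {M : Type*} [TopologicalSpace M]
  [ChartedSpace (EuclideanSpace ℝ (Fin n)) M] [IsManifold (𝓡 n) ∞ M]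

instance tangentFiniteDimensional (p : M) : FiniteDimensional ℝ (TangentSpace (𝓡 n) p) :=
  inferInstanceAs (FiniteDimensional ℝ (EuclideanSpace ℝ (Fin n)))

/-- The differential `df_p : T_pM → ℝ`, as a linear functional. -/
def differential (f : M → ℝ) (p : M) : Module.Dual ℝ (TangentSpace (𝓡 n) p) :=
  (mfderiv (𝓡 n) 𝓘(ℝ, ℝ) f p).toLinearMap

/-- The metric at the point `p`, as a bilinear form on `T_pM`. -/
def metricForm (g : SmoothMetric n M) (p : M) :
    LinearMap.BilinForm ℝ (TangentSpace (𝓡 n) p) :=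
  LinearMap.mk₂ ℝ (fun v w => g.inner p v w)
    (by intros; simp) (by intros; simp) (by intros; simp) (by intros; simp)

theorem metricForm_nondegenerate (g : SmoothMetric n M) (p : M) :
    (metricForm g p).Nondegenerate := by
  constructor
  · intro v hv
    by_contra h
    exact (g.pos p v h).ne' (hv v)
  · intro v hv
    by_contra h
    exact (g.pos p v h).ne' (hv v)

/-- The gradient `∇f` of `f` with respect to `g`, determined by `g(∇f, v) = df(v)`. -/
def grad (g : SmoothMetric n M) (f : M → ℝ) (p : M) : TangentSpace (𝓡 n) p :=
  ((metricForm g p).toDual (metricForm_nondegenerate g p)).symm (differential f p)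

theorem inner_grad (g : SmoothMetric n M) (f : M → ℝ) (p : M) (v : TangentSpace (𝓡 n) p) :
    g.inner p (grad g f p) v = mfderiv (𝓡 n) 𝓘(ℝ, ℝ) f p v :=
  LinearMap.BilinForm.apply_toDual_symm_apply (hB := metricForm_nondegenerate g p)
    (differential f p) v

/-- A trajectory `t ↦ φ_t p`, `t ∈ ℝ`, of the downward gradient flow `φ` of `f`. -/
def IsGradientTrajectory (g : SmoothMetric n M) (f : M → ℝ) (γ : ℝ → M) : Prop :=
  IsMIntegralCurve (I := 𝓡 n) γ (fun p => -grad g f p)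

/-- The unstable manifold of `x`: all `p` with `φ_t p → x` as `t → -∞`. -/
def unstableManifold (g : SmoothMetric n M) (f : M → ℝ) (x : M) : Set M :=
  {p | ∃ γ : ℝ → M, IsGradientTrajectory g f γ ∧ γ 0 = p ∧ Tendsto γ atBot (𝓝 x)}

/-- The stable manifold of `x`: all `p` with `φ_t p → x` as `t → ∞`. -/
def stableManifold (g : SmoothMetric n M) (f : M → ℝ) (x : M) : Set M :=
  {p | ∃ γ : ℝ → M, IsGradientTrajectory g f γ ∧ γ 0 = p ∧ Tendsto γ atTop (𝓝 x)}

end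

section

variable (n : ℕ) {M : Type*} [TopologicalSpace M]
  [ChartedSpace (EuclideanSpace ℝ (Fin n)) M]

/-- The set of critical points of `f`. -/
def Crit (f : M → ℝ) : Set M := {p | mfderiv (𝓡 n) 𝓘(ℝ, ℝ) f p = 0}

/-- `A ⊆ M` is ambient nullhomotopic to `m`: the identity of `M` is homotopic, through
differentiable (of class `C^1`) maps `M → M`, to a map which sends all of `A` to `m`. -/
def AmbientNullhomotopicTo (A : Set M) (m : M) : Prop :=
  ∃ h : unitInterval → M → M, Continuous (fun q : unitInterval × M => h q.1 q.2) ∧ h 0 = id ∧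
    (∀ t, ContMDiff (𝓡 n) (𝓡 n) 1 (h t)) ∧ ∀ a ∈ A, h 1 a = m

end

/-- `A ⊆ M` is nullhomotopic to `m`: the inclusion `A → M` is homotopic to the constant
map with value `m`. -/
def NullhomotopicTo {M : Type*} [TopologicalSpace M] (A : Set M) (m : M) : Prop :=
  ContinuousMap.Homotopic (⟨Subtype.val, continuous_subtype_val⟩ : C(A, M))
    (ContinuousMap.const A m)

end GradientCovers

end

/-!
The proof is dynamical: all that is used of the gradient flow is that it is a flow by `C^1` maps
with finitely many rest points `x i`, along which a continuous function `F` strictly increases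
(`IsLyapunov`). For the stable manifolds `F = -f` and the flow is the downward gradient flow; for
the unstable manifolds both are reversed.

Every `x i` has a small neighbourhood `B i` which is ambient nullhomotopic to it
(`exists_ambientNullhomotopicTo`): contract in a chart, damped by a bump function. By compactness
an orbit which leaves `B i` after a visit to a smaller neighbourhood `N i` has to gain a definite
amount of `F` in the shell between the two; if `F` varies less than that on `N i`, the orbit
cannot return to `N i`, nor visit `N j` for a rest point `x j` of the same level
(`IsLyapunov.exists_isTrap`). As `F` is bounded, every orbit visits some `N i`.

Hence the saturations `W i` of the sets `N i` under the flow form an open cover with the required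
disjointness, and `W i` contains the stable and the unstable manifold of `x i`. The times between
two visits of an orbit to `N i` form an interval spent inside `B i`, so a partition of unity
yields a continuous time at which to flow `W i` into `B i` (`IsTrap.exists_continuous_time`),
where it can be contracted.

For the ambient version, flow for constant times `T i` and put `U i = ψ (T i)⁻¹ (B i)`. The orbits
converging to a level `c` outside the sets `U j` of lower levels form part of a compact set on
which `F ≤ c`; there an orbit stays in `B i` after a visit to `N i`, so one time is late enough
for all points. Choosing the times level by level, from the lowest up, gives a cover
(`IsTrap.exists_times`); since times agree on a level, the disjointness of the `B i` is inherited.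

It remains to know that the gradient field is `C^1` (`contMDiff_grad`, Cramer's rule for the Gram
matrix of a local frame) and that a `C^1` field on a closed manifold has a complete flow by `C^1`
maps (`exists_flow`), which rests on the differentiable dependence of solutions of an ordinary
differential equation on the initial value (`contDiffOn_solution`, by Grönwall's inequality).
-/

/-! ### Flows with a Lyapunov function -/

namespace GradientCovers

section Lyapunov

variable {X ι : Type*} [TopologicalSpace X] (ψ : Flow ℝ X) (F : X → ℝ)

/-- `F` is a strict Lyapunov function of the flow `ψ` whose rest points are the values of `x`:
`F` is continuous and strictly increases along every orbit which is not one of these points. -/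
structure IsLyapunov (x : ι → X) : Prop where
  continuous : Continuous F
  fixed : ∀ i t, ψ t (x i) = x i
  lt : ∀ p, p ∉ range x → ∀ t, 0 < t → F p < F (ψ t p)

variable {ψ F} {x : ι → X}

namespace IsLyapunov

theorem le (h : IsLyapunov ψ F x) (p : X) {t : ℝ} (ht : 0 ≤ t) : F p ≤ F (ψ t p) := by
  rcases ht.eq_or_lt with rfl | ht
  · simp
  · by_cases hp : p ∈ range x
    · obtain ⟨i, rfl⟩ := hp
      rw [h.fixed]
    · exact (h.lt p hp t ht).le

theorem monotone (h : IsLyapunov ψ F x) (p : X) : Monotone fun t => F (ψ t p) := by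
  intro s t hst
  have := h.le (ψ s p) (sub_nonneg.2 hst)
  rwa [← ψ.map_add, sub_add_cancel] at this

/-- The gain of `F` in unit time is bounded below away from the rest points; as `F` is bounded,
every orbit visits any given neighbourhood of the rest points at arbitrarily late times. -/
theorem exists_visit [CompactSpace X] (h : IsLyapunov ψ F x) {N : Set X} (hN : IsOpen N)
    (hxN : range x ⊆ N) (p : X) (t₀ : ℝ) : ∃ t, t₀ ≤ t ∧ ψ t p ∈ N := by
  by_contra! hcon
  have hF := h.continuous
  have hne : (Nᶜ).Nonempty := ⟨_, hcon t₀ le_rfl⟩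
  obtain ⟨q, hq, hmin⟩ := hN.isClosed_compl.isCompact.exists_isMinOn hne
    (f := fun q => F (ψ 1 q) - F q) (by fun_prop)
  set m := F (ψ 1 q) - F q with hm
  have hm0 : 0 < m := sub_pos.2 (h.lt q (fun hqx => hq (hxN hqx)) 1 one_pos)
  have hgain : ∀ n : ℕ, F (ψ t₀ p) + n * m ≤ F (ψ (t₀ + n) p) := by
    intro n
    induction n with
    | zero => simp
    | succ n ih =>
      have h1 : m ≤ F (ψ 1 (ψ (t₀ + n) p)) - F (ψ (t₀ + n) p) :=
        hmin (hcon _ (by have := n.cast_nonneg (α := ℝ); linarith))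
      rw [← ψ.map_add] at h1
      have h2 : (1 : ℝ) + (t₀ + n) = t₀ + (n + 1 : ℕ) := by push_cast; ring
      rw [h2] at h1
      push_cast at h1 ⊢
      linarith
  obtain ⟨C, hC⟩ := (isCompact_range hF).bddAbove
  obtain ⟨n, hn⟩ := exists_nat_gt ((C - F (ψ t₀ p)) / m)
  rw [div_lt_iff₀ hm0] at hn
  have := hC ⟨_, rfl⟩ |>.trans' (hgain n)
  linarith

/-- `F` converges along every orbit to one of its values at the rest points, though the orbit itself
need not be known to converge. -/
theorem exists_tendsto [CompactSpace X] [Finite ι] (h : IsLyapunov ψ F x) (p : X) :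
    ∃ i, Tendsto (fun t => F (ψ t p)) atTop (𝓝 (F (x i))) := by
  have hF := h.continuous
  have hb : BddAbove (range fun t => F (ψ t p)) :=
    (isCompact_range hF).bddAbove.mono (by rintro _ ⟨t, rfl⟩; exact ⟨_, rfl⟩)
  have hlim := tendsto_atTop_ciSup (h.monotone p) hb
  set s := ⨆ t, F (ψ t p)
  suffices hs : s ∈ range (F ∘ x) by
    obtain ⟨i, hi⟩ := hs
    exact ⟨i, by rwa [← Function.comp_apply (f := F), hi]⟩
  by_contra hs
  obtain ⟨ε, hε, hball⟩ := Metric.isOpen_iff.1 (finite_range (F ∘ x)).isClosed.isOpen_compl s hs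
  obtain ⟨t₀, ht₀⟩ := eventually_atTop.1 (hlim.eventually (Metric.ball_mem_nhds s (half_pos hε)))
  obtain ⟨t, ht, htN⟩ := h.exists_visit (N := ⋃ i, F ⁻¹' Metric.ball (F (x i)) (ε / 2))
    (isOpen_iUnion fun i => Metric.isOpen_ball.preimage hF)
    (by rintro _ ⟨i, rfl⟩; exact mem_iUnion.2 ⟨i, Metric.mem_ball_self (half_pos hε)⟩) p t₀
  obtain ⟨i, hi⟩ := mem_iUnion.1 htN
  have h1 := ht₀ t ht
  refine hball (a := F (x i)) ?_ ⟨i, rfl⟩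
  have hi : dist (F (x i)) (F (ψ t p)) < ε / 2 := by rw [dist_comm]; exact hi
  rw [Metric.mem_ball]
  linarith [dist_triangle (F (x i)) (F (ψ t p)) s]

/-- An orbit which leaves `B` after having been close to the rest point `x i` gains a definite
amount of `F` while it crosses the shell between `B` and a smaller neighbourhood of `x i`. -/
theorem exists_trap [CompactSpace X] [T2Space X] (h : IsLyapunov ψ F x) {i : ι} {B : Set X}
    (hB : IsOpen B) (hiB : x i ∈ B) (hBx : ∀ j, x j ∈ B → x j = x i) :
    ∃ δ₀ > 0, ∀ δ > 0, δ ≤ δ₀ → ∃ N, IsOpen N ∧ x i ∈ N ∧ N ⊆ B ∧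
      (∀ q ∈ N, |F q - F (x i)| < δ) ∧
      ∀ q ∈ N, ∀ t, 0 ≤ t → ψ t q ∉ B → F (x i) + δ ≤ F (ψ t q) := by
  have hF := h.continuous
  obtain ⟨C, hC, hiC, hCB⟩ : ∃ C, IsOpen C ∧ x i ∈ C ∧ closure C ⊆ B := by
    obtain ⟨V, hV, hV', hVB⟩ := exists_mem_nhds_isClosed_subset (hB.mem_nhds hiB)
    exact ⟨interior V, isOpen_interior, mem_interior_iff_mem_nhds.2 hV,
      (closure_minimal interior_subset hV').trans hVB⟩
  -- the time needed to get from `closure C` out of `B` is bounded below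
  obtain ⟨τ, hτ, hτB⟩ : ∃ τ > 0, ∀ q ∈ closure C, ∀ t, 0 ≤ t → t ≤ τ → ψ t q ∈ B := by
    have hmem : ∀ q ∈ closure C, ∀ᶠ z in 𝓝 ((0 : ℝ), q), ψ z.1 z.2 ∈ B := fun q hq =>
      (ψ.continuous continuous_fst continuous_snd).continuousAt.eventually
        (hB.mem_nhds (by simpa using hCB hq))
    have := isClosed_closure.isCompact.eventually_forall_of_forall_eventually
      (x₀ := (0 : ℝ)) (P := fun t q => ψ t q ∈ B) hmem
    obtain ⟨τ, hτ, hτ'⟩ := Metric.eventually_nhds_iff_ball.1 this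
    refine ⟨τ / 2, half_pos hτ, fun q hq t ht ht' => hτ' t ?_ q hq⟩
    rw [Metric.mem_ball, Real.dist_eq, sub_zero, abs_of_nonneg ht]
    linarith
  -- the gain of `F` in time `τ` is bounded below on the compact set `closure C \ C`
  obtain ⟨m, hm, hmC⟩ : ∃ m > 0, ∀ q ∈ closure C \ C, F q + m ≤ F (ψ τ q) := by
    rcases (closure C \ C).eq_empty_or_nonempty with he | hne
    · exact ⟨1, one_pos, by simp [he]⟩
    obtain ⟨q, hq, hmin⟩ := (isClosed_closure.isCompact.diff hC).exists_isMinOn hne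
      (f := fun q => F (ψ τ q) - F q) (by fun_prop)
    refine ⟨F (ψ τ q) - F q, sub_pos.2 (h.lt q ?_ τ hτ), fun p hp => ?_⟩
    · rintro ⟨j, rfl⟩
      exact hq.2 (by rwa [hBx j (hCB hq.1)])
    · have : F (ψ τ q) - F q ≤ F (ψ τ p) - F p := hmin hp
      linarith
  refine ⟨m / 2, half_pos hm, fun δ hδ hδm => ⟨C ∩ {q | |F q - F (x i)| < δ},
    hC.inter (isOpen_lt (by fun_prop) continuous_const), ⟨hiC, by simpa using hδ⟩,
    fun q hq => hCB (subset_closure hq.1), fun q hq => hq.2, fun q hq t ht htB => ?_⟩⟩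
  -- the last time `s ≤ t` at which the orbit of `q` is in `closure C`
  obtain ⟨s, ⟨⟨hs0, hst⟩, hsC⟩, hsmax⟩ := ((isCompact_Icc (a := (0 : ℝ)) (b := t)).inter_right
    (isClosed_closure.preimage (by fun_prop : Continuous fun s => ψ s q))).exists_isGreatest
    (s := Icc 0 t ∩ (fun s => ψ s q) ⁻¹' closure C)
    ⟨0, ⟨le_rfl, ht⟩, by simpa using subset_closure hq.1⟩
  have hlt : s + τ < t := by
    by_contra! hle
    apply htB
    have := hτB _ hsC (t - s) (by linarith) (by linarith)
    rwa [← ψ.map_add, sub_add_cancel] at this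
  have hsC' : ψ s q ∉ C := by
    intro hmem
    have hev : ∀ᶠ r in 𝓝[>] s, ψ r q ∈ C := nhdsWithin_le_nhds
      ((by fun_prop : Continuous fun s => ψ s q).continuousAt.eventually (hC.mem_nhds hmem))
    obtain ⟨r, hrC, hsr, hrt⟩ := (hev.and (Ioo_mem_nhdsGT (by linarith : s < t))).exists
    exact absurd (hsmax ⟨⟨by linarith, hrt.le⟩, subset_closure hrC⟩) (not_le.2 hsr)
  have h1 := hmC _ ⟨hsC, hsC'⟩
  rw [← ψ.map_add] at h1
  have h2 := h.monotone q hs0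
  have h3 := h.monotone q (by linarith : τ + s ≤ t)
  have h4 := (abs_lt.1 (show |F q - F (x i)| < δ from hq.2)).1
  simp only [ψ.map_zero_apply] at h2 h3
  linarith

theorem le_of_tendsto (h : IsLyapunov ψ F x) {p : X} {c : ℝ}
    (hp : Tendsto (fun t => F (ψ t p)) atTop (𝓝 c)) (t : ℝ) : F (ψ t p) ≤ c :=
  (h.monotone p).ge_of_tendsto hp t

end IsLyapunov

/-- A time after which all of a compact set `L` is in a set `S`, if the orbits of points of `L`
enter `S` for good, locally uniformly. -/
theorem _root_.IsCompact.exists_forall_flow_mem {L S : Set X} (hL : IsCompact L)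
    (H : ∀ p ∈ L, ∃ a, ∀ᶠ q in 𝓝[L] p, ∀ t, a ≤ t → ψ t q ∈ S) :
    ∃ T, ∀ t, T ≤ t → ∀ q ∈ L, ψ t q ∈ S := by
  refine hL.induction_on (p := fun A => ∃ T, ∀ t, T ≤ t → ∀ q ∈ A, ψ t q ∈ S) ⟨0, by simp⟩
    (fun A A' hA ⟨T, hT⟩ => ⟨T, fun t ht q hq => hT t ht q (hA hq)⟩) ?_ fun p hp => ?_
  · rintro A A' ⟨T, hT⟩ ⟨T', hT'⟩
    refine ⟨max T T', fun t ht q hq => hq.elim (hT t ((le_max_left _ _).trans ht) q)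
      (hT' t ((le_max_right _ _).trans ht) q)⟩
  · obtain ⟨a, ha⟩ := H p hp
    exact ⟨_, ha, a, fun t ht q hq => hq t ht⟩

/-- Neighbourhoods `N i ⊆ B i` of the rest points such that an orbit which visits `N i` and then
leaves `B i` ends up above the level `F (x i) + δ`; the number `δ` separates the values of `F` at
the rest points. -/
structure IsTrap (ψ : Flow ℝ X) (F : X → ℝ) (x : ι → X) (B N : ι → Set X) (δ : ℝ) : Prop where
  pos : 0 < δ
  isOpen : ∀ i, IsOpen (N i)
  mem : ∀ i, x i ∈ N i
  subset : ∀ i, N i ⊆ B i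
  near : ∀ i, ∀ q ∈ N i, |F q - F (x i)| < δ
  leave : ∀ i, ∀ q ∈ N i, ∀ t, 0 ≤ t → ψ t q ∉ B i → F (x i) + δ ≤ F (ψ t q)
  disjoint : ∀ i j, i ≠ j → Disjoint (B i) (B j)
  separated : ∀ i j, |F (x i) - F (x j)| < 2 * δ → F (x i) = F (x j)

/-- The number of rest points being finite, one `δ` serves them all and separates their levels. -/
theorem IsLyapunov.exists_isTrap [CompactSpace X] [T2Space X] [Finite ι] (h : IsLyapunov ψ F x)
    {B : ι → Set X} (hB : ∀ i, IsOpen (B i)) (hxB : ∀ i, x i ∈ B i)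
    (hd : ∀ i j, i ≠ j → Disjoint (B i) (B j)) : ∃ N δ, IsTrap ψ F x B N δ := by
  have hBx : ∀ i j, x j ∈ B i → x j = x i := by
    intro i j hj
    by_contra hne
    exact (hd i j (fun e => hne (by rw [e]))).le_bot ⟨hj, hxB j⟩
  choose δ₀ hδ₀ H using fun i => h.exists_trap (hB i) (hxB i) (hBx i)
  obtain ⟨δ₁, hδ₁, hδ₁'⟩ : ∃ δ₁ > 0, ∀ i j, |F (x i) - F (x j)| < 2 * δ₁ → F (x i) = F (x j) := by
    have : ∀ᶠ δ in 𝓝[>] (0 : ℝ), ∀ i j, |F (x i) - F (x j)| < 2 * δ → F (x i) = F (x j) := by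
      refine eventually_all.2 fun i => eventually_all.2 fun j => ?_
      by_cases hij : F (x i) = F (x j)
      · exact Eventually.of_forall fun _ _ => hij
      · have hpos : 0 < |F (x i) - F (x j)| / 2 := half_pos (abs_pos.2 (sub_ne_zero.2 hij))
        filter_upwards [Ioo_mem_nhdsGT hpos] with δ hδ hlt
        linarith [hδ.2]
    exact ((eventually_mem_nhdsWithin).and this).exists
  obtain ⟨δ, hδ, hδle⟩ : ∃ δ > 0, ∀ i, δ ≤ δ₀ i := by
    have : ∀ᶠ δ in 𝓝[>] (0 : ℝ), ∀ i, δ ≤ δ₀ i :=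
      eventually_all.2 fun i => by
        filter_upwards [Ioo_mem_nhdsGT (hδ₀ i)] with δ hδ using hδ.2.le
    exact ((eventually_mem_nhdsWithin).and this).exists
  have hmin : 0 < min δ δ₁ := lt_min hδ hδ₁
  choose N hNo hxN hNB hnear hleave using
    fun i => H i (min δ δ₁) hmin ((min_le_left _ _).trans (hδle i))
  exact ⟨N, min δ δ₁, hmin, hNo, hxN, hNB, hnear, hleave, hd, fun i j hij =>
    hδ₁' i j (hij.trans_le (by gcongr; exact min_le_right _ _))⟩

namespace IsTrap

variable {B N : ι → Set X} {δ : ℝ}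

/-- An orbit stays in `B i` between two visits to `N i`, as `F` is monotone along orbits. -/
theorem mem_between (hT : IsTrap ψ F x B N δ) (h : IsLyapunov ψ F x) {i : ι} {p : X} {a s b : ℝ}
    (ha : ψ a p ∈ N i) (hb : ψ b p ∈ N i) (has : a ≤ s) (hsb : s ≤ b) : ψ s p ∈ B i := by
  by_contra hs
  have h1 := hT.leave i _ ha (s - a) (sub_nonneg.2 has)
  rw [← ψ.map_add, sub_add_cancel] at h1
  have h2 := h1 hs
  have h3 := h.monotone p hsb
  have h4 := (abs_lt.1 (hT.near i _ hb)).2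
  simp only at h3
  linarith

/-- An orbit which never rises above `F (x i)` stays in `B i` after a visit to `N i`. -/
theorem mem_of_le (hT : IsTrap ψ F x B N δ) {i : ι} {p : X} {a s : ℝ}
    (ha : ψ a p ∈ N i) (has : a ≤ s) (hs : F (ψ s p) ≤ F (x i)) : ψ s p ∈ B i := by
  by_contra hsB
  have h1 := hT.leave i _ ha (s - a) (sub_nonneg.2 has)
  rw [← ψ.map_add, sub_add_cancel] at h1
  linarith [h1 hsB, hT.pos]

/-- The points whose orbits visit `N i`. -/
def saturation (_hT : IsTrap ψ F x B N δ) (i : ι) : Set X := {p | ∃ t, ψ t p ∈ N i}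

theorem isOpen_saturation (hT : IsTrap ψ F x B N δ) (i : ι) : IsOpen (hT.saturation i) := by
  have : hT.saturation i = ⋃ t, ψ t ⁻¹' N i := by ext; simp [saturation]
  rw [this]
  exact isOpen_iUnion fun t => (hT.isOpen i).preimage (by fun_prop)

theorem mem_saturation_of_tendsto (hT : IsTrap ψ F x B N δ) {i : ι} {p : X} {l : Filter ℝ} [l.NeBot]
    (hp : Tendsto (fun t => ψ t p) l (𝓝 (x i))) : p ∈ hT.saturation i :=
  (hp.eventually ((hT.isOpen i).mem_nhds (hT.mem i))).exists

theorem iUnion_saturation [CompactSpace X] (hT : IsTrap ψ F x B N δ) (h : IsLyapunov ψ F x) :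
    ⋃ i, hT.saturation i = univ := by
  refine eq_univ_of_forall fun p => ?_
  obtain ⟨t, -, ht⟩ := h.exists_visit (isOpen_iUnion hT.isOpen)
    (by rintro _ ⟨i, rfl⟩; exact mem_iUnion.2 ⟨i, hT.mem i⟩) p 0
  obtain ⟨i, hi⟩ := mem_iUnion.1 ht
  exact mem_iUnion.2 ⟨i, t, hi⟩

/-- An orbit passing from `N i` to `N j` has left `B i`, so it has risen by `δ` above `F (x i)`,
while `F` is within `δ` of `F (x j)` on `N j`. -/
theorem disjoint_saturation (hT : IsTrap ψ F x B N δ) {i j : ι} (hij : i ≠ j)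
    (hF : F (x i) = F (x j)) : Disjoint (hT.saturation i) (hT.saturation j) := by
  have key : ∀ {i j : ι}, i ≠ j → F (x i) = F (x j) → ∀ {p : X} {a b : ℝ}, ψ a p ∈ N i →
      ψ b p ∈ N j → ¬ a ≤ b := by
    intro i j hij hF p a b ha hb hab
    have h1 := hT.leave i _ ha (b - a) (sub_nonneg.2 hab)
    rw [← ψ.map_add, sub_add_cancel] at h1
    have h2 := h1 fun hB => (hT.disjoint i j hij).le_bot ⟨hB, hT.subset j hb⟩
    have h3 := (abs_lt.1 (hT.near j _ hb)).2
    linarith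
  refine disjoint_left.2 ?_
  rintro p ⟨a, ha⟩ ⟨b, hb⟩
  rcases le_total a b with hab | hab
  · exact key hij hF ha hb hab
  · exact key hij.symm hF.symm hb ha hab

/-- The visiting times of `N i` span an interval of times spent in `B i`; a partition of unity
averages them to a continuous choice of such a time. -/
theorem exists_continuous_time [CompactSpace X] [TopologicalSpace.MetrizableSpace X]
    (hT : IsTrap ψ F x B N δ) (h : IsLyapunov ψ F x) (i : ι) :
    ∃ τ : C(hT.saturation i, ℝ), ∀ p, ψ (τ p) p ∈ B i := by
  let _ := TopologicalSpace.metrizableSpaceMetric X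
  obtain ⟨τ, hτ⟩ := exists_continuous_forall_mem_convex_of_local_const
    (X := hT.saturation i) (E := ℝ)
    (t := fun p => {s | ∃ a b, ψ a p ∈ N i ∧ ψ b p ∈ N i ∧ a ≤ s ∧ s ≤ b})
    (fun p => by
      refine OrdConnected.convex ⟨?_⟩
      rintro s ⟨a, -, ha, -, has, -⟩ t ⟨-, b, -, hb, -, htb⟩ r ⟨hsr, hrt⟩
      exact ⟨a, b, ha, hb, has.trans hsr, hrt.trans htb⟩)
    (fun p => by
      obtain ⟨t, ht⟩ := p.2
      refine ⟨t, ?_⟩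
      have : ∀ᶠ q : hT.saturation i in 𝓝 p, ψ t q ∈ N i :=
        (by fun_prop : Continuous fun q : hT.saturation i => ψ t q).continuousAt.eventually
          ((hT.isOpen i).mem_nhds ht)
      filter_upwards [this] with q hq using ⟨t, t, hq, hq, le_rfl, le_rfl⟩)
  refine ⟨τ, fun p => ?_⟩
  obtain ⟨a, b, ha, hb, has, hsb⟩ := hτ p
  exact hT.mem_between h ha hb has hsb

/-- An orbit in the stable set of `x i` stays below the level `F (x i)`, hence in `B i` after any
visit to `N i`; by compactness one time of entry serves all of `K`. -/
theorem exists_time_compact (hT : IsTrap ψ F x B N δ) (h : IsLyapunov ψ F x) {i : ι} {K : Set X}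
    (hK : IsCompact K) (hKi : ∀ p ∈ K, Tendsto (fun t => ψ t p) atTop (𝓝 (x i))) :
    ∃ T, ∀ t, T ≤ t → ∀ q ∈ K, ψ t q ∈ B i := by
  refine hK.exists_forall_flow_mem fun p hp => ?_
  obtain ⟨a, ha⟩ := ((hKi p hp).eventually ((hT.isOpen i).mem_nhds (hT.mem i))).exists
  refine ⟨a, ?_⟩
  have : ∀ᶠ q in 𝓝[K] p, ψ a q ∈ N i := nhdsWithin_le_nhds
    ((ψ.continuous_toFun a).continuousAt.eventually ((hT.isOpen i).mem_nhds ha))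
  filter_upwards [this, self_mem_nhdsWithin] with q hq hqK t ht
  exact hT.mem_of_le hq ht
    (h.le_of_tendsto ((h.continuous.tendsto _).comp (hKi q hqK)) t)

/-- Points whose orbits converge to level `c` without being in `O`, provided `O` takes care of the
lower levels, get into the sets `B i` with `F (x i) = c` after a common time. -/
theorem exists_time_level [CompactSpace X] [Finite ι] (hT : IsTrap ψ F x B N δ)
    (h : IsLyapunov ψ F x) {c : ℝ} {O : Set X} (hO : IsOpen O)
    (hlow : ∀ p j, F (x j) < c → Tendsto (fun t => F (ψ t p)) atTop (𝓝 (F (x j))) → p ∈ O) :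
    ∃ T, ∀ t, T ≤ t → ∀ p, Tendsto (fun t => F (ψ t p)) atTop (𝓝 c) → p ∉ O →
      ∃ i, F (x i) = c ∧ ψ t p ∈ B i := by
  have hF := h.continuous
  have hclosed : IsClosed ({p | ∀ t, F (ψ t p) ≤ c} ∩ Oᶜ) := by
    refine IsClosed.inter ?_ hO.isClosed_compl
    simp only [ofPred_forall]
    exact isClosed_iInter fun t => isClosed_le (by fun_prop) continuous_const
  obtain ⟨T, hTT⟩ := hclosed.isCompact.exists_forall_flow_mem (ψ := ψ)
    (S := ⋃ i, ⋃ _ : F (x i) = c, B i) (fun p hp => by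
      obtain ⟨j, hj⟩ := h.exists_tendsto p
      have hjc : F (x j) = c := by
        refine le_antisymm (le_of_tendsto' hj hp.1) ?_
        by_contra! hlt
        exact hp.2 (hlow p j hlt hj)
      obtain ⟨t₀, ht₀⟩ := eventually_atTop.1 (hj.eventually (Metric.ball_mem_nhds _ hT.pos))
      obtain ⟨a, hat, ha⟩ := h.exists_visit (isOpen_iUnion hT.isOpen)
        (by rintro _ ⟨i, rfl⟩; exact mem_iUnion.2 ⟨i, hT.mem i⟩) p t₀
      obtain ⟨i, hi⟩ := mem_iUnion.1 ha
      have hic : F (x i) = c := by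
        rw [← hjc]
        refine hT.separated i j ?_
        have h1 := abs_lt.1 (hT.near i _ hi)
        have h2 : |F (ψ a p) - F (x j)| < δ := ht₀ a hat
        rw [abs_lt] at h2 ⊢
        constructor <;> linarith
      refine ⟨a, ?_⟩
      have : ∀ᶠ q in 𝓝[{p | ∀ t, F (ψ t p) ≤ c} ∩ Oᶜ] p, ψ a q ∈ N i := nhdsWithin_le_nhds
        ((ψ.continuous_toFun a).continuousAt.eventually ((hT.isOpen i).mem_nhds hi))
      filter_upwards [this, self_mem_nhdsWithin] with q hq hqc t ht
      exact mem_iUnion₂.2 ⟨i, hic, hT.mem_of_le hq ht ((hqc.1 t).trans_eq hic.symm)⟩)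
  refine ⟨T, fun t ht p hp hpO => ?_⟩
  obtain ⟨i, hi, hiB⟩ := mem_iUnion₂.1 (hTT t ht p ⟨h.le_of_tendsto hp, hpO⟩)
  exact ⟨i, hi, hiB⟩

/-- Waiting times `T i`, equal for rest points of equal level, such that the preimages of the sets
`B i` under the time `T i` maps contain given compact sets and cover. The times are chosen level by
level, from the bottom up. -/
theorem exists_times [CompactSpace X] [Finite ι] (hT : IsTrap ψ F x B N δ)
    (h : IsLyapunov ψ F x) (hB : ∀ i, IsOpen (B i)) {K : ι → Set X} (hK : ∀ i, IsCompact (K i))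
    (hKx : ∀ i, ∀ p ∈ K i, Tendsto (fun t => ψ t p) atTop (𝓝 (x i))) :
    ∃ T : ι → ℝ, (∀ i j, F (x i) = F (x j) → T i = T j) ∧ (∀ i, ∀ p ∈ K i, ψ (T i) p ∈ B i) ∧
      ∀ p, ∃ i, ψ (T i) p ∈ B i := by
  classical
  have := Fintype.ofFinite ι
  choose S hS using fun i => hT.exists_time_compact h (hK i) (hKx i)
  -- induction on the number of rest points below the level `c`
  suffices H : ∀ (n : ℕ) (c : ℝ), (Finset.univ.filter fun i => F (x i) < c).card ≤ n →
      ∃ T : ι → ℝ, (∀ i j, F (x i) = F (x j) → T i = T j) ∧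
        (∀ i, F (x i) < c → ∀ p ∈ K i, ψ (T i) p ∈ B i) ∧
        ∀ p j, F (x j) < c → Tendsto (fun t => F (ψ t p)) atTop (𝓝 (F (x j))) →
          ∃ i, F (x i) < c ∧ ψ (T i) p ∈ B i by
    obtain ⟨c, hc⟩ := (finite_range (F ∘ x)).bddAbove
    have hc' : ∀ i, F (x i) < c + 1 := fun i => (hc ⟨i, rfl⟩).trans_lt (lt_add_one c)
    obtain ⟨T, h1, h2, h3⟩ := H _ (c + 1) le_rfl
    refine ⟨T, h1, fun i => h2 i (hc' i), fun p => ?_⟩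
    obtain ⟨j, hj⟩ := h.exists_tendsto p
    obtain ⟨i, -, hi⟩ := h3 p j (hc' j) hj
    exact ⟨i, hi⟩
  intro n
  induction n with
  | zero =>
    intro c hc
    have hno : ∀ i, ¬ F (x i) < c := by
      simpa [Finset.filter_eq_empty_iff] using hc
    exact ⟨fun _ => 0, fun _ _ _ => rfl, fun i hi => absurd hi (hno i),
      fun p j hj => absurd hj (hno j)⟩
  | succ n ih =>
    intro c hc
    rcases (Finset.univ.filter fun i => F (x i) < c).eq_empty_or_nonempty with he | hne
    · exact ih c (by simp [he])
    obtain ⟨m, hm, hmax⟩ := Finset.exists_max_image _ (fun i => F (x i)) hne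
    simp only [Finset.mem_filter, Finset.mem_univ, true_and] at hm hmax
    obtain ⟨T, h1, h2, h3⟩ := ih (F (x m)) (by
      refine Nat.le_of_lt_succ (lt_of_lt_of_le (Finset.card_lt_card ?_) hc)
      refine Finset.ssubset_iff_subset_ne.2 ⟨fun i hi => ?_, fun he => ?_⟩
      · simp only [Finset.mem_filter, Finset.mem_univ, true_and] at hi ⊢
        exact hi.trans hm
      · have : m ∈ Finset.univ.filter fun i => F (x i) < c := by simpa using hm
        rw [← he] at this
        simp at this)
    obtain ⟨R, hR⟩ := hT.exists_time_level h (c := F (x m))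
      (O := ⋃ i, ⋃ _ : F (x i) < F (x m), ψ (T i) ⁻¹' B i)
      (isOpen_iUnion fun i => isOpen_iUnion fun _ => (hB i).preimage (by fun_prop))
      (fun p j hj hp => by
        obtain ⟨i, hi, hiB⟩ := h3 p j hj hp
        exact mem_iUnion₂.2 ⟨i, hi, hiB⟩)
    obtain ⟨R', hR'⟩ := (finite_range S).bddAbove
    set U := max R R'
    refine ⟨fun i => if F (x i) = F (x m) then U else T i, fun i j hij => ?_,
      fun i hi p hp => ?_, fun p j hj hp => ?_⟩
    · simp only [hij, h1 i j hij]
    · by_cases him : F (x i) = F (x m)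
      · simp only [him, if_true]
        exact hS i U ((hR' ⟨i, rfl⟩).trans (le_max_right _ _)) p hp
      · simp only [him, if_false]
        exact h2 i ((hmax i hi).lt_of_ne him) p hp
    · by_cases hpO : p ∈ ⋃ i, ⋃ _ : F (x i) < F (x m), ψ (T i) ⁻¹' B i
      · obtain ⟨i, hi, hiB⟩ := mem_iUnion₂.1 hpO
        exact ⟨i, hi.trans hm, by simpa only [hi.ne, if_false, mem_preimage] using hiB⟩
      · have hjm : F (x j) = F (x m) := by
          refine le_antisymm (hmax j hj) ?_
          by_contra! hlt
          obtain ⟨i, hi, hiB⟩ := h3 p j hlt hp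
          exact hpO (mem_iUnion₂.2 ⟨i, hi, hiB⟩)
        obtain ⟨i, hi, hiB⟩ := hR U (le_max_left _ _) p (hjm ▸ hp) hpO
        exact ⟨i, hi.trans_lt hm, by simpa only [hi, if_true] using hiB⟩

end IsTrap

end Lyapunov

end GradientCovers

/-! ### Differentiable dependence of solutions of an ODE on the initial value -/

namespace GradientCovers

section ODE

open scoped NNReal

variable {E : Type*} [NormedAddCommGroup E] [NormedSpace ℝ E]

theorem hasDerivWithinAt_Ici_of_Icc {G : Type*} [NormedAddCommGroup G] [NormedSpace ℝ G]
    {c : ℝ → G} {c' : G} {T t : ℝ} (h : HasDerivWithinAt c c' (Icc 0 T) t) (ht : t ∈ Ico 0 T) :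
    HasDerivWithinAt c c' (Ici t) t :=
  h.mono_of_mem_nhdsWithin (Icc_mem_nhdsGE_of_mem ht)

theorem gronwallBound_zero_eq (K ε t : ℝ) :
    gronwallBound 0 K ε t = ε * gronwallBound 0 K 1 t := by
  unfold gronwallBound
  split_ifs <;> ring

variable {w : E → E} {K : ℝ≥0} {T : ℝ}

/-- The linearisation of `c' = w ∘ c` along a curve, started at the identity, has a solution. -/
theorem exists_linearized_solution [CompleteSpace E] (hw : ContDiff ℝ 1 w)
    (hK : ∀ x, ‖fderiv ℝ w x‖ ≤ K) (hT : 0 ≤ T) (hKT : 2 * K * T ≤ 1) {c : ℝ → E}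
    (hc : ContinuousOn c (Icc 0 T)) :
    ∃ J : ℝ → E →L[ℝ] E, J 0 = .id ℝ E ∧ ∀ t ∈ Icc 0 T,
      HasDerivWithinAt J ((fderiv ℝ w (c t)).comp (J t)) (Icc 0 T) t := by
  have hA : ContinuousOn (fun t => fderiv ℝ w (c t)) (Icc 0 T) :=
    (hw.continuous_fderiv (by simp)).comp_continuousOn hc
  have hid : ‖ContinuousLinearMap.id ℝ E‖ ≤ 1 := ContinuousLinearMap.norm_id_le
  have hpl : IsPicardLindelof (fun (t : ℝ) (B : E →L[ℝ] E) => (fderiv ℝ w (c t)).comp B)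
      (⟨0, le_rfl, hT⟩ : Icc 0 T) (ContinuousLinearMap.id ℝ E) 1 0 (2 * K) K := by
    constructor
    · intro t _
      refine LipschitzOnWith.of_dist_le_mul fun B _ B' _ => ?_
      rw [dist_eq_norm, dist_eq_norm, ← ContinuousLinearMap.comp_sub]
      exact (ContinuousLinearMap.opNorm_comp_le _ _).trans (by gcongr; exact hK _)
    · exact fun B _ => hA.clm_comp continuousOn_const
    · intro t _ B hB
      have hB' : ‖B‖ ≤ 2 := by
        rw [mem_closedBall_iff_norm] at hB
        have := norm_le_norm_add_norm_sub' B (.id ℝ E)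
        simp only [NNReal.coe_one] at hB
        linarith
      calc ‖(fderiv ℝ w (c t)).comp B‖ ≤ ‖fderiv ℝ w (c t)‖ * ‖B‖ :=
            ContinuousLinearMap.opNorm_comp_le _ _
        _ ≤ K * 2 := by gcongr; exact hK _
        _ = (2 * K : ℝ≥0) := by push_cast; ring
    · simp only [sub_zero, sub_self, max_eq_left hT]
      push_cast
      linarith
  exact hpl.exists_eq_forall_mem_Icc_hasDerivWithinAt₀

theorem norm_linearized_solution_le (hK : ∀ x, ‖fderiv ℝ w x‖ ≤ K) {c : ℝ → E}
    {J : ℝ → E →L[ℝ] E} (hJ0 : J 0 = .id ℝ E) (hJ : ∀ t ∈ Icc 0 T,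
      HasDerivWithinAt J ((fderiv ℝ w (c t)).comp (J t)) (Icc 0 T) t) {t : ℝ} (ht : t ∈ Icc 0 T) :
    ‖J t‖ ≤ Real.exp (K * T) := by
  have := norm_le_gronwallBound_of_norm_deriv_right_le (f := J) (δ := 1) (K := K) (ε := 0)
    (fun t ht => (hJ t ht).continuousWithinAt)
    (fun s hs => hasDerivWithinAt_Ici_of_Icc (hJ s (Ico_subset_Icc_self hs)) hs)
    (by rw [hJ0]; exact ContinuousLinearMap.norm_id_le)
    (fun s _ => by
      rw [add_zero]
      exact (ContinuousLinearMap.opNorm_comp_le _ _).trans (by gcongr; exact hK _)) t ht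
  rw [gronwallBound_ε0, sub_zero, one_mul] at this
  exact this.trans (Real.exp_le_exp.2 (by gcongr; exact ht.2))

theorem dist_solution_le (hK : LipschitzWith K w) {c c' : ℝ → E}
    (hc : ∀ t ∈ Icc 0 T, HasDerivWithinAt c (w (c t)) (Icc 0 T) t)
    (hc' : ∀ t ∈ Icc 0 T, HasDerivWithinAt c' (w (c' t)) (Icc 0 T) t) {t : ℝ} (ht : t ∈ Icc 0 T) :
    ‖c' t - c t‖ ≤ Real.exp (K * T) * ‖c' 0 - c 0‖ := by
  have := dist_le_of_trajectories_ODE (v := fun _ => w) (K := K) (fun _ => hK)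
    (fun t ht => (hc' t ht).continuousWithinAt)
    (fun s hs => hasDerivWithinAt_Ici_of_Icc (hc' s (Ico_subset_Icc_self hs)) hs)
    (fun t ht => (hc t ht).continuousWithinAt)
    (fun s hs => hasDerivWithinAt_Ici_of_Icc (hc s (Ico_subset_Icc_self hs)) hs) le_rfl t ht
  rw [dist_eq_norm, dist_eq_norm, sub_zero, mul_comm] at this
  exact this.trans (by gcongr; exact ht.2)

/-- Solutions of `c' = w ∘ c` depend on the initial value in a continuously differentiable way; the
derivative solves the linearised equation. Both facts follow from Grönwall's inequality and the
uniform continuity of the derivative of `w`. -/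
theorem contDiffOn_solution [CompleteSpace E] (hw : ContDiff ℝ 1 w) (hs : HasCompactSupport w)
    (hK : ∀ x, ‖fderiv ℝ w x‖ ≤ K) (hT : 0 ≤ T) (hKT : 2 * K * T ≤ 1) {U : Set E} (hU : IsOpen U)
    {α : E → ℝ → E} (h0 : ∀ x ∈ U, α x 0 = x)
    (hα : ∀ x ∈ U, ∀ t ∈ Icc 0 T, HasDerivWithinAt (α x) (w (α x t)) (Icc 0 T) t) {t : ℝ}
    (ht : t ∈ Icc 0 T) : ContDiffOn ℝ 1 (fun x => α x t) U := by
  have hdw : Differentiable ℝ w := hw.differentiable (by simp)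
  have hlip : LipschitzWith K w := lipschitzWith_of_nnnorm_fderiv_le hdw hK
  have huc : UniformContinuous (fderiv ℝ w) :=
    (hs.fderiv ℝ).uniformContinuous_of_continuous (hw.continuous_fderiv (by simp))
  have hcont : ∀ x ∈ U, ContinuousOn (α x) (Icc 0 T) :=
    fun x hx t ht => (hα x hx t ht).continuousWithinAt
  choose! J hJ0 hJ using fun x (hx : x ∈ U) =>
    exists_linearized_solution hw hK hT hKT (hcont x hx)
  have hJn : ∀ x ∈ U, ∀ s ∈ Icc 0 T, ‖J x s‖ ≤ Real.exp (K * T) := fun x hx s hs =>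
    norm_linearized_solution_le hK (hJ0 x hx) (hJ x hx) hs
  set M := Real.exp (K * T)
  have hM : 0 < M := Real.exp_pos _
  have hd : ∀ x ∈ U, ∀ y ∈ U, ∀ s ∈ Icc 0 T, ‖α y s - α x s‖ ≤ M * ‖y - x‖ := by
    intro x hx y hy s hs
    simpa only [h0 x hx, h0 y hy] using dist_solution_le hlip (hα x hx) (hα y hy) hs
  set G := gronwallBound 0 K 1 t
  have hG : 0 ≤ G := by
    have := gronwallBound_mono (δ := 0) (K := K) (ε := 1) le_rfl zero_le_one K.2 ht.1
    rwa [gronwallBound_x0] at this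
  have hderiv : ∀ x ∈ U, HasFDerivAt (fun x => α x t) (J x t) x := by
    intro x hx
    rw [hasFDerivAt_iff_isLittleO, Asymptotics.isLittleO_iff]
    intro ε hε
    obtain ⟨η, hη, hηε⟩ : ∃ η > 0, η * M * G ≤ ε :=
      ⟨ε / (M * G + 1), by positivity, by
        rw [mul_assoc, div_mul_eq_mul_div, div_le_iff₀ (by positivity)]
        gcongr; linarith⟩
    obtain ⟨δ, hδ, huc'⟩ := Metric.uniformContinuous_iff.1 huc η hη
    filter_upwards [hU.mem_nhds hx, Metric.ball_mem_nhds x (div_pos hδ hM)] with y hy hyδ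
    rw [Metric.mem_ball, dist_eq_norm, lt_div_iff₀ hM, mul_comm] at hyδ
    -- the error of the first order expansion satisfies a linear differential inequality
    have hb := norm_le_gronwallBound_of_norm_deriv_right_le
      (f := fun s => α y s - α x s - J x s (y - x))
      (f' := fun s => w (α y s) - w (α x s) - ((fderiv ℝ w (α x s)).comp (J x s)) (y - x))
      (δ := 0) (K := K) (ε := η * (M * ‖y - x‖)) (a := 0) (b := T)
      (((hcont y hy).sub (hcont x hx)).sub
        (ContinuousOn.clm_apply (fun s hs => (hJ x hx s hs).continuousWithinAt) continuousOn_const))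
      (fun s hs => by
        have hs' := Ico_subset_Icc_self hs
        have h1 := hasDerivWithinAt_Ici_of_Icc (hJ x hx s hs') hs
        exact ((hasDerivWithinAt_Ici_of_Icc (hα y hy s hs') hs).sub
          (hasDerivWithinAt_Ici_of_Icc (hα x hx s hs') hs)).sub
          (by simpa using h1.clm_apply (hasDerivWithinAt_const s (Ici s) (y - x))))
      (by simp [hJ0 x hx, h0 x hx, h0 y hy])
      (fun s hs => by
        have hs' := Ico_subset_Icc_self hs
        have hmv : ‖w (α y s) - w (α x s) - fderiv ℝ w (α x s) (α y s - α x s)‖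
            ≤ η * ‖α y s - α x s‖ := by
          have hlt := (hd x hx y hy s hs').trans_lt hyδ
          refine (convex_ball (α x s) δ).norm_image_sub_le_of_norm_fderiv_le' (𝕜 := ℝ)
            (fun z _ => hdw z) (fun z hz => ?_) (Metric.mem_ball_self hδ)
            (by rwa [mem_ball_iff_norm])
          rw [← dist_eq_norm]
          exact (huc' hz).le
        have heq : w (α y s) - w (α x s) - ((fderiv ℝ w (α x s)).comp (J x s)) (y - x)
            = fderiv ℝ w (α x s) (α y s - α x s - J x s (y - x)) +
              (w (α y s) - w (α x s) - fderiv ℝ w (α x s) (α y s - α x s)) := by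
          simp only [map_sub, ContinuousLinearMap.comp_apply]
          abel
        rw [heq]
        refine (norm_add_le _ _).trans (add_le_add ?_ (hmv.trans ?_))
        · exact (ContinuousLinearMap.le_opNorm _ _).trans (by gcongr; exact hK _)
        · gcongr
          exact hd x hx y hy s hs') t ht
    rw [sub_zero, gronwallBound_zero_eq] at hb
    calc ‖α y t - α x t - J x t (y - x)‖ ≤ η * (M * ‖y - x‖) * G := hb
      _ = η * M * G * ‖y - x‖ := by ring
      _ ≤ ε * ‖y - x‖ := by gcongr
  have hJc : ContinuousOn (fun x => J x t) U := by
    intro x hx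
    rw [Metric.continuousWithinAt_iff]
    intro ε hε
    obtain ⟨η, hη, hηε⟩ : ∃ η > 0, η * M * G < ε :=
      ⟨ε / (M * G + 1), by positivity, by
        rw [mul_assoc, div_mul_eq_mul_div, div_lt_iff₀ (by positivity)]
        gcongr; linarith⟩
    obtain ⟨δ, hδ, huc'⟩ := Metric.uniformContinuous_iff.1 huc η hη
    refine ⟨δ / M, div_pos hδ hM, fun y hy hyδ => ?_⟩
    rw [dist_eq_norm, lt_div_iff₀ hM, mul_comm] at hyδ
    -- and so does the difference of two solutions of the linearised equations
    have hb := norm_le_gronwallBound_of_norm_deriv_right_le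
      (f := fun s => J y s - J x s)
      (f' := fun s => (fderiv ℝ w (α y s)).comp (J y s) - (fderiv ℝ w (α x s)).comp (J x s))
      (δ := 0) (K := K) (ε := η * M) (a := 0) (b := T)
      (ContinuousOn.sub (fun s hs => (hJ y hy s hs).continuousWithinAt)
        (fun s hs => (hJ x hx s hs).continuousWithinAt))
      (fun s hs => by
        have hs' := Ico_subset_Icc_self hs
        exact (hasDerivWithinAt_Ici_of_Icc (hJ y hy s hs') hs).sub
          (hasDerivWithinAt_Ici_of_Icc (hJ x hx s hs') hs))
      (by simp [hJ0 x hx, hJ0 y hy])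
      (fun s hs => by
        have hs' := Ico_subset_Icc_self hs
        have heq : (fderiv ℝ w (α y s)).comp (J y s) - (fderiv ℝ w (α x s)).comp (J x s)
            = (fderiv ℝ w (α x s)).comp (J y s - J x s) +
              (fderiv ℝ w (α y s) - fderiv ℝ w (α x s)).comp (J y s) := by
          rw [ContinuousLinearMap.comp_sub, ContinuousLinearMap.sub_comp]
          abel
        rw [heq]
        refine (norm_add_le _ _).trans (add_le_add ?_ ?_)
        · exact (ContinuousLinearMap.opNorm_comp_le _ _).trans (by gcongr; exact hK _)
        · refine (ContinuousLinearMap.opNorm_comp_le _ _).trans ?_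
          gcongr
          · rw [← dist_eq_norm]
            refine (huc' ?_).le
            rw [dist_eq_norm]
            exact (hd x hx y hy s hs').trans_lt hyδ
          · exact hJn y hy s hs') t ht
    rw [sub_zero, gronwallBound_zero_eq] at hb
    rw [dist_eq_norm]
    exact hb.trans_lt hηε
  intro x hx
  refine ContDiffAt.contDiffWithinAt ?_
  rw [contDiffAt_one_iff]
  exact ⟨fun x => J x t, U, hU.mem_nhds hx, hJc, hderiv⟩

/-- A `C^1` vector field of compact support has a local flow around every point which is continuous
and of class `C^1` in the initial value. -/
theorem exists_local_flow [CompleteSpace E] (hw : ContDiff ℝ 1 w) (hs : HasCompactSupport w)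
    (x₀ : E) : ∃ ε > (0 : ℝ), ∃ α : E → ℝ → E,
      (∀ x ∈ Metric.ball x₀ 1, α x 0 = x) ∧
      (∀ x ∈ Metric.ball x₀ 1, ∀ t ∈ Ioo (-ε) ε, HasDerivAt (α x) (w (α x t)) t) ∧
      ContinuousOn (fun z : E × ℝ => α z.1 z.2) (Metric.ball x₀ 1 ×ˢ Ioo (-ε) ε) ∧
      ∀ t ∈ Ioo (-ε) ε, ContDiffOn ℝ 1 (fun x => α x t) (Metric.ball x₀ 1) := by
  obtain ⟨C, hC⟩ := hs.exists_bound_of_continuous hw.continuous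
  obtain ⟨C', hC'⟩ := (hs.fderiv ℝ).exists_bound_of_continuous (hw.continuous_fderiv (by simp))
  set L : ℝ≥0 := C.toNNReal
  set K : ℝ≥0 := C'.toNNReal
  have hL : ∀ x, ‖w x‖ ≤ L := fun x => (hC x).trans (Real.le_coe_toNNReal C)
  have hK : ∀ x, ‖fderiv ℝ w x‖ ≤ K := fun x => (hC' x).trans (Real.le_coe_toNNReal C')
  have hdw : Differentiable ℝ w := hw.differentiable (by simp)
  obtain ⟨ε, hε, hKε⟩ : ∃ ε > (0 : ℝ), 2 * K * ε ≤ 1 :=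
    ⟨1 / (2 * K + 1), by positivity, by
      rw [mul_one_div, div_le_one (by positivity)]; linarith⟩
  have hpl : IsPicardLindelof (fun _ => w) (tmin := -ε) (tmax := ε) ⟨0, by simp [hε.le]⟩
      x₀ (L * ε.toNNReal + 1) 1 L K :=
    IsPicardLindelof.of_time_independent (fun x _ => hL x)
      (lipschitzWith_of_nnnorm_fderiv_le hdw hK).lipschitzOnWith
      (by simp [hε.le])
  obtain ⟨α, hα, hαc⟩ := hpl.exists_forall_mem_closedBall_eq_hasDerivWithinAt_continuousOn
  have hsub : Metric.ball x₀ 1 ⊆ Metric.closedBall x₀ (1 : ℝ≥0) := Metric.ball_subset_closedBall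
  refine ⟨ε, hε, fun x t => α (x, t), fun x hx => (hα x (hsub hx)).1, fun x hx t ht =>
    ((hα x (hsub hx)).2 t (Ioo_subset_Icc_self ht)).hasDerivAt (Icc_mem_nhds ht.1 ht.2),
    hαc.mono (prod_mono hsub Ioo_subset_Icc_self), fun t ht => ?_⟩
  rcases le_total 0 t with h0 | h0
  · exact contDiffOn_solution hw hs hK hε.le hKε Metric.isOpen_ball
      (α := fun x t => α (x, t)) (fun x hx => (hα x (hsub hx)).1)
      (fun x hx t ht => ((hα x (hsub hx)).2 t ⟨by linarith [ht.1], ht.2⟩).mono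
        (Icc_subset_Icc (by linarith) le_rfl)) ⟨h0, ht.2.le⟩
  · -- negative times: reverse the time and the vector field
    have := contDiffOn_solution (w := -w) (t := -t) hw.neg hs.neg
      (fun x => by rw [fderiv_neg, norm_neg]; exact hK x) hε.le hKε Metric.isOpen_ball
      (α := fun x t => α (x, -t)) (fun x hx => by simpa using (hα x (hsub hx)).1)
      (fun x hx t ht => by
        have h1 := (hα x (hsub hx)).2 (-t) ⟨by linarith [ht.2], by linarith [ht.1]⟩
        have hm : MapsTo (fun s : ℝ => -s) (Icc 0 ε) (Icc (-ε) ε) :=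
          fun s hs => ⟨by linarith [hs.2], by linarith [hs.1, hε]⟩
        have h2 := h1.scomp t (hasDerivAt_neg t).hasDerivWithinAt hm
        simpa [Function.comp_def] using h2) ⟨by linarith, by linarith [ht.1]⟩
    simpa using this

end ODE

end GradientCovers

/-! ### The flow of a vector field of class `C^1` on a closed manifold -/

namespace GradientCovers

section Flow

variable {n : ℕ} {M : Type*} [TopologicalSpace M]
  [ChartedSpace (EuclideanSpace ℝ (Fin n)) M] [IsManifold (𝓡 n) 1 M]

/-- Local integral curves of a `C^1` vector field `v`, depending continuously on time and initial
value and in a `C^1` way on the latter. In a chart, `v` is multiplied by a bump function. -/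
theorem exists_local_flow_manifold {v : (p : M) → TangentSpace (𝓡 n) p}
    (hv : ContMDiff (𝓡 n) (𝓡 n).tangent 1 (fun p => (⟨p, v p⟩ : TangentBundle (𝓡 n) M))) (p₀ : M) :
    ∃ ε > (0 : ℝ), ∃ U, IsOpen U ∧ p₀ ∈ U ∧ ∃ Φ : M → ℝ → M,
      (∀ p ∈ U, Φ p 0 = p) ∧ (∀ p ∈ U, IsMIntegralCurveOn (I := 𝓡 n) (Φ p) v (Ioo (-ε) ε)) ∧
      ContinuousOn (fun z : M × ℝ => Φ z.1 z.2) (U ×ˢ Ioo (-ε) ε) ∧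
      ∀ t ∈ Ioo (-ε) ε, ContMDiffOn (𝓡 n) (𝓡 n) 1 (fun p => Φ p t) U := by
  set c := extChartAt (𝓡 n) p₀ with hc
  set y₀ := c p₀ with hy₀
  set v' : EuclideanSpace ℝ (Fin n) → EuclideanSpace ℝ (Fin n) := fun y =>
    tangentCoordChange (𝓡 n) (c.symm y) p₀ (c.symm y) (v (c.symm y)) with hv'
  have hv'C : ContDiffAt ℝ 1 v' y₀ := by
    have h1 := hv.contMDiffAt (x := p₀)
    rw [contMDiffAt_iff] at h1
    exact (h1.2.contDiffAt (by simp)).snd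
  have htarget : c.target ∈ 𝓝 y₀ := extChartAt_target_mem_nhds p₀
  obtain ⟨R, hR, hRt⟩ := Metric.nhds_basis_ball.mem_iff.1
    (inter_mem htarget (hv'C.eventually (by simp)))
  let χ : ContDiffBump y₀ := ⟨R / 3, R / 2, by positivity, by linarith⟩
  set w : EuclideanSpace ℝ (Fin n) → EuclideanSpace ℝ (Fin n) := fun y => χ y • v' y with hw
  have hwC : ContDiff ℝ 1 w := by
    rw [contDiff_iff_contDiffAt]
    intro y
    by_cases hy : y ∈ Metric.ball y₀ R
    · exact χ.contDiffAt.smul (hRt hy).2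
    · have hyt : y ∉ tsupport χ := by
        rw [χ.tsupport_eq]
        intro hmem
        exact hy (Metric.closedBall_subset_ball (by change R / 2 < R; linarith) hmem)
      refine (contDiffAt_const (c := (0 : EuclideanSpace ℝ (Fin n)))).congr_of_eventuallyEq ?_
      filter_upwards [notMem_tsupport_iff_eventuallyEq.1 hyt] with z hz
      simp [hw, hz]
  have hws : HasCompactSupport w := χ.hasCompactSupport.smul_right
  obtain ⟨ε₁, hε₁, α, hα0, hα, hαc, hαd⟩ := exists_local_flow hwC hws y₀
  -- shrink the domain so that the curves stay where `w = v'`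
  have hcont0 : ContinuousAt (fun z : EuclideanSpace ℝ (Fin n) × ℝ => α z.1 z.2) (y₀, 0) :=
    hαc.continuousAt (prod_mem_nhds (Metric.ball_mem_nhds _ one_pos)
      (Ioo_mem_nhds (by linarith) hε₁))
  have hα00 : α y₀ 0 = y₀ := hα0 _ (Metric.mem_ball_self one_pos)
  have hnear : ∀ᶠ z in 𝓝 (y₀, (0 : ℝ)), α z.1 z.2 ∈ Metric.ball y₀ (R / 3) :=
    hcont0.eventually (Metric.isOpen_ball.mem_nhds (by simp [hα00, hR]))
  rw [nhds_prod_eq, eventually_prod_iff] at hnear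
  obtain ⟨pa, hpa, pb, hpb, hab⟩ := hnear
  obtain ⟨r, hr, hra⟩ := Metric.eventually_nhds_iff_ball.1 hpa
  obtain ⟨ε₂, hε₂, hεb⟩ := Metric.eventually_nhds_iff_ball.1 hpb
  set ε := min ε₁ ε₂
  set V := Metric.ball y₀ (min r 1)
  have hVr : V ⊆ Metric.ball y₀ r := Metric.ball_subset_ball (min_le_left _ _)
  have hV1 : V ⊆ Metric.ball y₀ 1 := Metric.ball_subset_ball (min_le_right _ _)
  have hε1 : Ioo (-ε) ε ⊆ Ioo (-ε₁) ε₁ :=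
    Ioo_subset_Ioo (neg_le_neg (min_le_left _ _)) (min_le_left _ _)
  have hstay : ∀ y ∈ V, ∀ t ∈ Ioo (-ε) ε, α y t ∈ Metric.ball y₀ (R / 3) := by
    intro y hy t ht
    refine hab (hra y (hVr hy)) (hεb t ?_)
    rw [Metric.mem_ball, Real.dist_eq, sub_zero, abs_lt]
    exact ⟨by linarith [ht.1, min_le_right ε₁ ε₂], by linarith [ht.2, min_le_right ε₁ ε₂]⟩
  have hball : Metric.ball y₀ (R / 3) ⊆ c.target := fun y hy =>
    (hRt (Metric.ball_subset_ball (by linarith) hy)).1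
  have hderiv : ∀ y ∈ V, ∀ t ∈ Ioo (-ε) ε, HasDerivAt (α y) (v' (α y t)) t := by
    intro y hy t ht
    have h1 := hα y (hV1 hy) t (hε1 ht)
    have h2 : χ (α y t) = 1 := χ.one_of_mem_closedBall
      (Metric.ball_subset_closedBall (hstay y hy t ht))
    simpa only [hw, h2, one_smul] using h1
  have hcU : ContMDiffOn (𝓡 n) 𝓘(ℝ, EuclideanSpace ℝ (Fin n)) 1 c c.source := by
    rw [hc, extChartAt_source]
    exact contMDiffOn_extChartAt
  refine ⟨ε, lt_min hε₁ hε₂, c.source ∩ c ⁻¹' V, ?_, ⟨mem_extChartAt_source p₀,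
    Metric.mem_ball_self (lt_min hr one_pos)⟩, fun p t => c.symm (α (c p) t), fun p hp => ?_,
    fun p hp t ht => ?_, ?_, fun t ht => ?_⟩
  · exact (continuousOn_extChartAt p₀).isOpen_inter_preimage (isOpen_extChartAt_source p₀)
      Metric.isOpen_ball
  · change c.symm (α (c p) 0) = p
    rw [hα0 _ (hV1 hp.2), c.left_inv hp.1]
  · -- the curve `c.symm ∘ α (c p)` has velocity `v`, by the rule for coordinate changes
    set q : M := c.symm (α (c p) t) with hq
    have h : HasDerivAt (α (c p)) (tangentCoordChange (𝓡 n) q p₀ q (v q)) t :=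
      hderiv _ hp.2 t ht
    have hmem : α (c p) t ∈ c.target := hball (hstay _ hp.2 t ht)
    have hq1 : q ∈ c.source := c.map_target hmem
    have hq2 := mem_extChartAt_source (I := 𝓡 n) q
    apply HasMFDerivAt.hasMFDerivWithinAt
    refine ⟨(continuousAt_extChartAt_symm'' hmem).comp h.continuousAt, ?_⟩
    have h3 : HasFDerivWithinAt (extChartAt (𝓡 n) q ∘ c.symm)
        (tangentCoordChange (𝓡 n) p₀ q q) (range (𝓡 n)) (c q) :=
      hasFDerivWithinAt_tangentCoordChange ⟨hq1, hq2⟩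
    rw [show c q = α (c p) t from c.right_inv hmem] at h3
    have h4 := (h3.hasFDerivAt (by simp)).comp_hasDerivAt t h
    have h5 := (h4.congr_deriv ((tangentCoordChange_comp ⟨⟨hq2, hq1⟩, hq2⟩).trans
      (tangentCoordChange_self hq2))).hasFDerivAt.hasFDerivWithinAt (s := univ)
    rw [ContinuousLinearMap.smulRight_one_eq_toSpanSingleton]
    simp only [mfld_simps]
    exact h5
  · have h1 : ContinuousOn (fun z : M × ℝ => (c z.1, z.2)) ((c.source ∩ c ⁻¹' V) ×ˢ Ioo (-ε) ε) :=
      ((hcU.continuousOn.comp continuousOn_fst fun z hz => hz.1.1).prodMk continuousOn_snd)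
    exact (continuousOn_extChartAt_symm p₀).comp
      (hαc.comp h1 fun z hz => ⟨hV1 hz.1.2, hε1 hz.2⟩)
      fun z hz => hball (hstay _ hz.1.2 _ hz.2)
  · have h1 : ContMDiffOn 𝓘(ℝ, EuclideanSpace ℝ (Fin n)) 𝓘(ℝ, EuclideanSpace ℝ (Fin n)) 1
        (fun y => α y t) V := ((hαd t (hε1 ht)).mono hV1).contMDiffOn
    exact (contMDiffOn_extChartAt_symm p₀).comp
      (h1.comp (hcU.mono inter_subset_left) fun p hp => hp.2)
      fun p hp => hball (hstay _ hp.2 _ ht)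

/-- A property of real numbers which holds near `0` and is stable under addition always holds. -/
theorem forall_real_of_add {P : ℝ → Prop} {ε : ℝ} (hε : 0 < ε) (h0 : ∀ t ∈ Ioo (-ε) ε, P t)
    (hadd : ∀ s t, P s → P t → P (s + t)) (t : ℝ) : P t := by
  obtain ⟨N, hN⟩ := exists_nat_gt (|t| / ε)
  have hN0 : 0 < (N : ℝ) := lt_of_le_of_lt (by positivity) hN
  have hs : P (t / N) := by
    refine h0 _ (abs_lt.1 ?_)
    rw [abs_div, Nat.abs_cast, div_lt_iff₀ hN0]
    rwa [div_lt_iff₀ hε, mul_comm] at hN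
  have key : ∀ k : ℕ, P (k * (t / N)) := by
    intro k
    induction k with
    | zero => simpa using h0 0 ⟨by linarith, hε⟩
    | succ k ih =>
      have := hadd _ _ ih hs
      push_cast
      rwa [add_mul, one_mul]
  have := key N
  rwa [mul_div_cancel₀ _ hN0.ne'] at this

/-- A vector field of class `C^1` on a closed manifold is complete, and its flow consists of maps of
class `C^1`. -/
theorem exists_flow [CompactSpace M] [T2Space M] {v : (p : M) → TangentSpace (𝓡 n) p}
    (hv : ContMDiff (𝓡 n) (𝓡 n).tangent 1 (fun p => (⟨p, v p⟩ : TangentBundle (𝓡 n) M))) :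
    ∃ φ : Flow ℝ M, (∀ p, IsMIntegralCurve (I := 𝓡 n) (fun t => φ t p) v) ∧
      ∀ t, ContMDiff (𝓡 n) (𝓡 n) 1 (φ t) := by
  choose ε hε U hU hpU Φ hΦ0 hΦ hΦc hΦd using exists_local_flow_manifold hv
  obtain ⟨S, hS⟩ := isCompact_univ.elim_finite_subcover U hU
    (fun p _ => mem_iUnion.2 ⟨p, hpU p⟩)
  obtain ⟨η, hη, hηε⟩ : ∃ η > (0 : ℝ), ∀ p ∈ S, η ≤ ε p := by
    have : ∀ᶠ η in 𝓝[>] (0 : ℝ), ∀ p ∈ S, η ≤ ε p :=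
      (Finset.eventually_all S).2 fun p _ => by
        filter_upwards [Ioo_mem_nhdsGT (hε p)] with δ hδ using hδ.2.le
    exact ((eventually_mem_nhdsWithin).and this).exists
  have hcov : ∀ p, ∃ q ∈ S, p ∈ U q := fun p => by
    obtain ⟨q, hq, hpq⟩ := mem_iUnion₂.1 (hS (mem_univ p))
    exact ⟨q, hq, hpq⟩
  have hsub : ∀ q ∈ S, Ioo (-η) η ⊆ Ioo (-ε q) (ε q) := fun q hq =>
    Ioo_subset_Ioo (neg_le_neg (hηε q hq)) (hηε q hq)
  have h0η : (0 : ℝ) ∈ Ioo (-η) η := ⟨by linarith, hη⟩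
  choose γ hγ0 hγ using exists_isMIntegralCurve_of_isMIntegralCurveOn hv hη fun p => by
    obtain ⟨q, hq, hpq⟩ := hcov p
    exact ⟨Φ q p, hΦ0 q p hpq, (hΦ q p hpq).mono (hsub q hq)⟩
  have hadd : ∀ s t p, γ p (s + t) = γ (γ p t) s := fun s t p => congrFun
    (isMIntegralCurve_Ioo_eq_of_contMDiff_boundaryless (t₀ := 0) hv ((hγ p).comp_add t)
      (hγ (γ p t)) (by simp [hγ0])) s
  have hlocal : ∀ q ∈ S, ∀ p ∈ U q, ∀ t ∈ Ioo (-η) η, γ p t = Φ q p t := fun q hq p hp t ht =>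
    isMIntegralCurveOn_Ioo_eqOn_of_contMDiff_boundaryless h0η hv
      ((hγ p).isMIntegralCurveOn _) ((hΦ q p hp).mono (hsub q hq)) (by rw [hγ0, hΦ0 q p hp]) ht
  have hC1 : ∀ t, ContMDiff (𝓡 n) (𝓡 n) 1 (fun p => γ p t) := by
    refine forall_real_of_add hη (fun t ht p => ?_) fun s t hs ht => ?_
    · obtain ⟨q, hq, hpq⟩ := hcov p
      refine ((hΦd q t (hsub q hq ht)).contMDiffAt ((hU q).mem_nhds hpq)).congr_of_eventuallyEq ?_
      filter_upwards [(hU q).mem_nhds hpq] with r hr using hlocal q hq r hr t ht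
    · simp only [hadd]
      exact hs.comp ht
  -- joint continuity at time `0`, which the group law carries to all times
  have hc0 : ∀ p, ContinuousAt (fun z : ℝ × M => γ z.2 z.1) (0, p) := by
    intro p
    obtain ⟨q, hq, hpq⟩ := hcov p
    have hnhds : U q ×ˢ Ioo (-η) η ∈ 𝓝 (p, (0 : ℝ)) :=
      prod_mem_nhds ((hU q).mem_nhds hpq) (Ioo_mem_nhds h0η.1 h0η.2)
    have h1 : ContinuousAt (fun z : M × ℝ => γ z.1 z.2) (p, 0) := by
      refine ((hΦc q).mono (prod_mono le_rfl (hsub q hq))).continuousAt hnhds |>.congr ?_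
      filter_upwards [hnhds] with z hz using (hlocal q hq _ hz.1 _ hz.2).symm
    exact ContinuousAt.comp (f := Prod.swap) (g := fun z : M × ℝ => γ z.1 z.2) h1
      continuous_swap.continuousAt
  refine ⟨⟨fun t p => γ p t, ?_, fun s t p => hadd s t p, hγ0⟩, hγ, hC1⟩
  rw [continuous_iff_continuousAt]
  rintro ⟨t, p⟩
  have heq : Function.uncurry (fun t p => γ p t) = (fun z : ℝ × M => γ z.2 z.1) ∘
      fun z : ℝ × M => (z.1 - t, γ z.2 t) := by
    ext z
    simp [← hadd, Function.uncurry]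
  rw [heq]
  refine ContinuousAt.comp ?_ (Continuous.continuousAt ?_)
  · simpa using hc0 (γ p t)
  · exact (continuous_fst.sub continuous_const).prodMk ((hC1 t).continuous.comp continuous_snd)

end Flow

end GradientCovers

/-! ### Regularity of the gradient field -/

namespace GradientCovers

section Gradient

variable {n : ℕ} {M : Type*} [TopologicalSpace M]
  [ChartedSpace (EuclideanSpace ℝ (Fin n)) M] [IsManifold (𝓡 n) ∞ M]

theorem contDiff_det {m : ℕ} {k : WithTop ℕ∞} :
    ContDiff ℝ k (fun A : Fin m → Fin m → ℝ => (Matrix.of A).det) := by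
  simp only [Matrix.det_apply, Matrix.of_apply]
  refine ContDiff.sum fun σ _ => ContDiff.const_smul _ (contDiff_prod fun i _ => ?_)
  fun_prop

theorem grad_eq_zero_iff (g : SmoothMetric n M) (f : M → ℝ) (p : M) :
    grad g f p = 0 ↔ p ∈ Crit n f := by
  constructor
  · intro h
    ext v
    change mfderiv (𝓡 n) 𝓘(ℝ, ℝ) f p v = 0
    rw [← inner_grad g, h]
    simp
    rfl
  · intro h
    by_contra h0
    have h1 := g.pos p _ h0
    rw [inner_grad] at h1
    have h2 : mfderiv (𝓡 n) 𝓘(ℝ, ℝ) f p = 0 := h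
    rw [h2] at h1
    exact lt_irrefl _ h1

theorem contMDiffAt_mfderiv_apply {f : M → ℝ} (hf : ContMDiff (𝓡 n) 𝓘(ℝ, ℝ) 2 f)
    {s : (p : M) → TangentSpace (𝓡 n) p} {p₀ : M}
    (hs : ContMDiffAt (𝓡 n) (𝓡 n).tangent 1 (fun p => (⟨p, s p⟩ : TangentBundle (𝓡 n) M)) p₀) :
    ContMDiffAt (𝓡 n) 𝓘(ℝ, ℝ) 1 (fun p => (mfderiv (𝓡 n) 𝓘(ℝ, ℝ) f p (s p) : ℝ)) p₀ := by
  have h1 := (hf.contMDiff_tangentMap (m := 1) (by norm_num)).contMDiffAt.comp p₀ hs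
  exact (contMDiff_snd_tangentBundle_modelSpace ℝ 𝓘(ℝ, ℝ)).contMDiffAt.comp p₀ h1

theorem contMDiffAt_inner (g : SmoothMetric n M) {s s' : (p : M) → TangentSpace (𝓡 n) p} {p₀ : M}
    (hs : ContMDiffAt (𝓡 n) (𝓡 n).tangent 1 (fun p => (⟨p, s p⟩ : TangentBundle (𝓡 n) M)) p₀)
    (hs' : ContMDiffAt (𝓡 n) (𝓡 n).tangent 1 (fun p => (⟨p, s' p⟩ : TangentBundle (𝓡 n) M)) p₀) :
    ContMDiffAt (𝓡 n) 𝓘(ℝ, ℝ) 1 (fun p => g.inner p (s p) (s' p)) p₀ := by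
  have h : ContMDiffAt (𝓡 n) ((𝓡 n).prod 𝓘(ℝ, ℝ)) 1
      (fun p => Bundle.TotalSpace.mk' ℝ (E := Bundle.Trivial M ℝ) p (g.inner p (s p) (s' p))) p₀ :=
    ContMDiffAt.clm_bundle_apply₂ (F₁ := EuclideanSpace ℝ (Fin n))
      (F₂ := EuclideanSpace ℝ (Fin n)) (g.contMDiff.of_le (by norm_cast)).contMDiffAt hs hs'
  rw [Bundle.contMDiffAt_totalSpace] at h
  exact h.2

/-- The gradient of a `C^2` function is of class `C^1`: its coefficients in a local frame are given
by Cramer's rule applied to the Gram matrix of the frame. -/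
theorem contMDiff_grad (g : SmoothMetric n M) {f : M → ℝ} (hf : ContMDiff (𝓡 n) 𝓘(ℝ, ℝ) 2 f) :
    ContMDiff (𝓡 n) (𝓡 n).tangent 1 (fun p => (⟨p, grad g f p⟩ : TangentBundle (𝓡 n) M)) := by
  intro p₀
  let e := trivializationAt (EuclideanSpace ℝ (Fin n)) (TangentSpace (𝓡 n) : M → Type _) p₀
  let b := (EuclideanSpace.basisFun (Fin n) ℝ).toBasis
  have hp₀ : p₀ ∈ e.baseSet := FiberBundle.mem_baseSet_trivializationAt' p₀
  let s := e.localFrame b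
  have hs : ∀ i, ContMDiffAt (𝓡 n) (𝓡 n).tangent 1
      (fun p => (⟨p, s i p⟩ : TangentBundle (𝓡 n) M)) p₀ :=
    fun i => contMDiffAt_localFrame_of_mem 1 e b i hp₀
  let A : M → Fin n → Fin n → ℝ := fun p i j => g.inner p (s j p) (s i p)
  let d : M → Fin n → ℝ := fun p i => mfderiv (𝓡 n) 𝓘(ℝ, ℝ) f p (s i p)
  have hA : ContMDiffAt (𝓡 n) 𝓘(ℝ, Fin n → Fin n → ℝ) 1 A p₀ :=
    contMDiffAt_pi_space.2 fun i => contMDiffAt_pi_space.2 fun j =>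
      contMDiffAt_inner g (hs j) (hs i)
  have hd : ContMDiffAt (𝓡 n) 𝓘(ℝ, Fin n → ℝ) 1 d p₀ :=
    contMDiffAt_pi_space.2 fun i => contMDiffAt_mfderiv_apply hf (hs i)
  -- a kernel vector of the Gram matrix would give a tangent vector orthogonal to itself
  have hdet : ∀ p ∈ e.baseSet, (Matrix.of (A p)).det ≠ 0 := by
    intro p hp h0
    obtain ⟨c, hc, hAc⟩ := Matrix.exists_mulVec_eq_zero_iff.2 h0
    set u : TangentSpace (𝓡 n) p := ∑ j, c j • s j p with hu
    have hli : LinearIndependent ℝ fun i => s i p :=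
      (e.isLocalFrameOn_localFrame_baseSet (𝓡 n) 1 b).linearIndependent hp
    have hu0 : u ≠ 0 := fun h => hc (funext fun i => Fintype.linearIndependent_iff.1 hli c h i)
    have hui : ∀ i, g.inner p u (s i p) = 0 := fun i => by
      have := congrFun hAc i
      simp only [Matrix.mulVec, dotProduct, Matrix.of_apply, Pi.zero_apply, A] at this
      rw [hu, map_sum, sum_apply, ← this]
      exact Finset.sum_congr rfl fun j _ => by simp [mul_comm]
    have h1 := g.pos p u hu0
    have h2 : g.inner p u u = 0 := by
      conv_lhs => rw [hu, map_sum]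
      exact Finset.sum_eq_zero fun i _ => by rw [map_smul, hui i, smul_zero]
    exact h1.ne' h2
  rw [contMDiffAt_iff_localFrameCoeff b hp₀]
  intro i
  have hquot : ContMDiffAt (𝓡 n) 𝓘(ℝ, ℝ) 1 (fun p =>
      ((Matrix.of (A p)).det)⁻¹ * (Matrix.of (A p)).cramer (d p) i) p₀ := by
    have h1 : ContMDiffAt (𝓡 n) 𝓘(ℝ, ℝ) 1 (fun p => (Matrix.of (A p)).det) p₀ :=
      contDiff_det.contMDiff.contMDiffAt.comp p₀ hA
    have h2 : ContMDiffAt (𝓡 n) 𝓘(ℝ, ℝ) 1 (fun p => (Matrix.of (A p)).cramer (d p) i) p₀ := by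
      have h3 : ContMDiffAt (𝓡 n) 𝓘(ℝ, Fin n → Fin n → ℝ) 1
          (fun p k j => (Matrix.of (A p)).updateCol i (d p) k j) p₀ := by
        refine contMDiffAt_pi_space.2 fun k => contMDiffAt_pi_space.2 fun j => ?_
        simp only [Matrix.updateCol_apply, Matrix.of_apply]
        split_ifs
        · exact contMDiffAt_pi_space.1 hd k
        · exact contMDiffAt_pi_space.1 (contMDiffAt_pi_space.1 hA k) j
      exact contDiff_det.contMDiff.contMDiffAt.comp p₀ h3
    exact (h1.inv₀ (hdet p₀ hp₀)).mul h2
  refine hquot.congr_of_eventuallyEq ?_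
  filter_upwards [e.open_baseSet.mem_nhds hp₀] with p hp
  set c : Fin n → ℝ := fun j => e.localFrameCoeff (𝓡 n) b j p (grad g f p) with hc
  have hsum : grad g f p = ∑ j, c j • s j p :=
    Bundle.Trivialization.eq_sum_localFrameCoeff_smul hp (s := grad g f)
  have hAc : (Matrix.of (A p)).mulVec c = d p := by
    ext k
    change _ = mfderiv (𝓡 n) 𝓘(ℝ, ℝ) f p (s k p)
    rw [← inner_grad g, hsum, map_sum, sum_apply]
    change ∑ j, g.inner p (s j p) (s k p) * c j = _
    exact Finset.sum_congr rfl fun j _ => by simp [mul_comm]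
  have hcr : (Matrix.of (A p)).cramer (d p) = (Matrix.of (A p)).det • c := by
    rw [Matrix.cramer_eq_adjugate_mulVec, ← hAc, Matrix.mulVec_mulVec, Matrix.adjugate_mul,
      Matrix.smul_mulVec, Matrix.one_mulVec]
  rw [hcr, Pi.smul_apply, smul_eq_mul, inv_mul_cancel_left₀ (hdet p hp)]
  rfl

end Gradient

end GradientCovers

/-! ### Contracting a small ball by a homotopy of the whole manifold -/

namespace GradientCovers

section Contraction

variable {n : ℕ} {M : Type*} [TopologicalSpace M] [T2Space M]
  [ChartedSpace (EuclideanSpace ℝ (Fin n)) M] [IsManifold (𝓡 n) ∞ M]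

/-- Every point has arbitrarily small neighbourhoods which are ambient nullhomotopic to it: in a
chart, pull towards the point with a strength prescribed by a bump function. -/
theorem exists_ambientNullhomotopicTo (x : M) {O : Set M} (hO : O ∈ 𝓝 x) :
    ∃ B, IsOpen B ∧ x ∈ B ∧ B ⊆ O ∧ AmbientNullhomotopicTo n B x := by
  classical
  let χ : SmoothBumpFunction (𝓡 n) x := Classical.arbitrary _
  set c := extChartAt (𝓡 n) x with hc
  have hsource : IsOpen c.source := isOpen_extChartAt_source x
  have hχ : ContMDiff (𝓡 n) 𝓘(ℝ, ℝ) 1 χ := χ.contMDiff.of_le (by norm_cast)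
  have hcsm : ContMDiffOn (𝓡 n) 𝓘(ℝ, EuclideanSpace ℝ (Fin n)) 1 c c.source := by
    rw [hc, extChartAt_source]
    exact contMDiffOn_extChartAt
  let k : ℝ → M → EuclideanSpace ℝ (Fin n) := fun t p => c p + (t * χ p) • (c x - c p)
  have hk : ∀ t ∈ Icc (0 : ℝ) 1, ∀ p ∈ c.source, k t p ∈ c.target := by
    intro t ht p hp
    by_cases hp0 : χ p = 0
    · simpa [k, hp0] using c.map_source hp
    · have hp' : p ∈ Function.support χ := hp0
      rw [χ.support_eq_inter_preimage] at hp'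
      refine χ.ball_subset ⟨?_, by simp⟩
      refine (convex_ball (c x) χ.rOut).add_smul_sub_mem hp'.2 (Metric.mem_ball_self χ.rOut_pos)
        ⟨mul_nonneg ht.1 χ.nonneg, mul_le_one₀ ht.2 χ.nonneg χ.le_one⟩
  let h : unitInterval → M → M := fun t p => if p ∈ c.source then c.symm (k t p) else p
  have hin : ∀ t, ∀ p ∈ c.source, h t p = c.symm (k t p) := fun t p hp => if_pos hp
  have hout : ∀ t, ∀ p ∉ tsupport χ, h t p = p := by
    intro t p hp
    by_cases hps : p ∈ c.source
    · rw [hin t p hps]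
      simp [k, image_eq_zero_of_notMem_tsupport hp, c.left_inv hps]
    · exact if_neg hps
  have hopen : IsOpen (tsupport χ)ᶜ := (isClosed_tsupport χ).isOpen_compl
  have hcov : ∀ p, p ∉ c.source → p ∉ tsupport χ := fun p hp hpt =>
    hp (by rw [hc, extChartAt_source]; exact χ.tsupport_subset_chartAt_source hpt)
  have hone : {p | χ p = 1} ∈ 𝓝 x := χ.eventuallyEq_one
  obtain ⟨B, hBO, hB, hxB⟩ := mem_nhds_iff.1
    (inter_mem hO (inter_mem (hsource.mem_nhds (mem_extChartAt_source x)) hone))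
  refine ⟨B, hB, hxB, fun p hp => (hBO hp).1, h, ?_, ?_, fun t p => ?_, fun a ha => ?_⟩
  · rw [continuous_iff_continuousAt]
    rintro ⟨t, p⟩
    by_cases hp : p ∈ c.source
    · have h1 : ContinuousOn (fun q : unitInterval × M => c.symm (k q.1 q.2))
          (univ ×ˢ c.source) := by
        have h2 : ContinuousOn (fun q : unitInterval × M => c q.2) (univ ×ˢ c.source) :=
          hcsm.continuousOn.comp continuousOn_snd fun q hq => hq.2
        have h3 : Continuous (fun q : unitInterval × M => (q.1 : ℝ) * χ q.2) :=
          (continuous_subtype_val.comp continuous_fst).mul (hχ.continuous.comp continuous_snd)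
        exact (continuousOn_extChartAt_symm x).comp
          (h2.add (h3.continuousOn.smul (continuousOn_const.sub h2)))
          fun q hq => hk q.1 q.1.2 q.2 hq.2
      have hnhds : univ ×ˢ c.source ∈ 𝓝 (t, p) := prod_mem_nhds univ_mem (hsource.mem_nhds hp)
      refine (h1.continuousAt hnhds).congr ?_
      filter_upwards [hnhds] with q hq using (hin q.1 q.2 hq.2).symm
    · refine continuousAt_snd.congr ?_
      filter_upwards [prod_mem_nhds univ_mem (hopen.mem_nhds (hcov p hp))] with q hq
        using (hout q.1 q.2 hq.2).symm
  · ext p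
    by_cases hp : p ∈ c.source
    · simp [hin 0 p hp, k, c.left_inv hp]
    · exact if_neg hp
  · by_cases hp : p ∈ c.source
    · have h1 : ContMDiffOn (𝓡 n) (𝓡 n) 1 (fun q => c.symm (k t q)) c.source :=
        (contMDiffOn_extChartAt_symm x).comp
          (hcsm.add (((contMDiff_const.mul hχ).contMDiffOn).smul (contMDiffOn_const.sub hcsm)))
          fun q hq => hk t t.2 q hq
      refine (h1.contMDiffAt (hsource.mem_nhds hp)).congr_of_eventuallyEq ?_
      filter_upwards [hsource.mem_nhds hp] with q hq using hin t q hq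
    · refine contMDiffAt_id.congr_of_eventuallyEq ?_
      filter_upwards [hopen.mem_nhds (hcov p hp)] with q hq using hout t q hq
  · obtain ⟨-, has, ha1⟩ := hBO ha
    have ha1 : χ a = 1 := ha1
    rw [hin 1 a has]
    simp [k, ha1, hc]

end Contraction

end GradientCovers

/-! ### Covers from a Lyapunov flow -/

namespace GradientCovers

section Reverse

variable {X ι : Type*} [TopologicalSpace X] {ψ : Flow ℝ X} {F : X → ℝ} {x : ι → X}

theorem IsLyapunov.reverse (h : IsLyapunov ψ F x) : IsLyapunov ψ.reverse (fun p => -F p) x where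
  continuous := h.continuous.neg
  fixed i t := by rw [Flow.reverse_apply, h.fixed]
  lt p hp t ht := by
    rw [Flow.reverse_apply, neg_lt_neg_iff]
    have hq : ψ (-t) p ∉ range x := by
      rintro ⟨i, hi⟩
      refine hp ⟨i, ?_⟩
      have := congrArg (ψ t) hi
      rwa [h.fixed, ← ψ.map_add, add_neg_cancel, ψ.map_zero_apply] at this
    simpa [← ψ.map_add] using h.lt _ hq t ht

end Reverse

section Covers

variable {n : ℕ} {M ι : Type*} [TopologicalSpace M] [T2Space M] [CompactSpace M]
  [ChartedSpace (EuclideanSpace ℝ (Fin n)) M] [IsManifold (𝓡 n) ∞ M] [Finite ι]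
  {ψ : Flow ℝ M} {F : M → ℝ} {x : ι → M}

/-- Disjoint ambient nullhomotopic neighbourhoods of the rest points, with a trap in them. -/
theorem IsLyapunov.exists_isTrap_ambientNullhomotopicTo (h : IsLyapunov ψ F x)
    (hx : Function.Injective x) : ∃ (B N : ι → Set M) (δ : ℝ), IsTrap ψ F x B N δ ∧
      ∀ i, IsOpen (B i) ∧ AmbientNullhomotopicTo n (B i) (x i) := by
  obtain ⟨O, hO, hd⟩ := (finite_range x).t2_separation
  choose B hB hxB hBO hBx using fun i =>
    exists_ambientNullhomotopicTo (n := n) (x i) ((hO (x i)).2.mem_nhds (hO (x i)).1)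
  obtain ⟨N, δ, hT⟩ := h.exists_isTrap hB hxB fun i j hij =>
    (hd ⟨i, rfl⟩ ⟨j, rfl⟩ (hx.ne hij)).mono (hBO i) (hBO j)
  exact ⟨B, N, δ, hT, fun i => ⟨hB i, hBx i⟩⟩

/-- The saturations of the trap neighbourhoods contain the points whose orbits accumulate at the
rest point, in either direction of time. -/
theorem IsLyapunov.exists_nullhomotopic_cover (n : ℕ)
    [ChartedSpace (EuclideanSpace ℝ (Fin n)) M] [IsManifold (𝓡 n) ∞ M] (h : IsLyapunov ψ F x)
    (hx : Function.Injective x) : ∃ W : ι → Set M, (⋃ i, W i) = univ ∧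
      (∀ i, IsOpen (W i) ∧ (∀ (l : Filter ℝ) [l.NeBot] (p : M),
        Tendsto (fun t => ψ t p) l (𝓝 (x i)) → p ∈ W i) ∧ NullhomotopicTo (W i) (x i)) ∧
      ∀ i j, i ≠ j → F (x i) = F (x j) → Disjoint (W i) (W j) := by
  obtain ⟨B, N, δ, hT, hB⟩ := h.exists_isTrap_ambientNullhomotopicTo (n := n) hx
  have : TopologicalSpace.MetrizableSpace M := Manifold.metrizableSpace (𝓡 n) M
  refine ⟨hT.saturation, hT.iUnion_saturation h, fun i => ⟨hT.isOpen_saturation i,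
    fun l _ p hp => hT.mem_saturation_of_tendsto hp, ?_⟩, fun i j => hT.disjoint_saturation⟩
  obtain ⟨τ, hτ⟩ := hT.exists_continuous_time h i
  obtain ⟨k, hk, hk0, -, hk1⟩ := (hB i).2
  -- flow into `B i` and contract `B i` at the same time
  refine ⟨⟨⟨fun q => k q.1 (ψ (q.1 * τ q.2) q.2), ?_⟩, fun p => ?_, fun p => ?_⟩⟩
  · exact hk.comp (continuous_fst.prodMk (ψ.continuous
      ((continuous_subtype_val.comp continuous_fst).mul (τ.continuous.comp continuous_snd))
      (continuous_subtype_val.comp continuous_snd)))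
  · simp [hk0]
  · simpa using hk1 _ (hτ p)

/-- The cover consists of the preimages, under the flow for suitable times, of small ambient
nullhomotopic neighbourhoods of the rest points. -/
theorem IsLyapunov.exists_ambientNullhomotopic_cover (h : IsLyapunov ψ F x)
    (hx : Function.Injective x) (hψ : ∀ t, ContMDiff (𝓡 n) (𝓡 n) 1 (ψ t)) {K : ι → Set M}
    (hK : ∀ i, IsCompact (K i))
    (hKx : ∀ i, ∀ p ∈ K i, Tendsto (fun t => ψ t p) atTop (𝓝 (x i))) :
    ∃ U : ι → Set M, (⋃ i, U i) = univ ∧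
      (∀ i, IsOpen (U i) ∧ K i ⊆ U i ∧ AmbientNullhomotopicTo n (U i) (x i)) ∧
      ∀ i j, i ≠ j → F (x i) = F (x j) → Disjoint (U i) (U j) := by
  obtain ⟨B, N, δ, hT, hB⟩ := h.exists_isTrap_ambientNullhomotopicTo (n := n) hx
  obtain ⟨T, hTF, hTK, hTc⟩ := hT.exists_times h (fun i => (hB i).1) hK hKx
  refine ⟨fun i => ψ (T i) ⁻¹' B i, eq_univ_of_forall fun p => mem_iUnion.2 (hTc p),
    fun i => ⟨(hB i).1.preimage (hψ _).continuous, hTK i, ?_⟩, fun i j hij hF => ?_⟩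
  · obtain ⟨k, hk, hk0, hks, hk1⟩ := (hB i).2
    refine ⟨fun t p => k t (ψ (t * T i) p), ?_, ?_, fun t => (hks t).comp (hψ _),
      fun a ha => by simpa using hk1 _ ha⟩
    · exact hk.comp (continuous_fst.prodMk (ψ.continuous
        ((continuous_subtype_val.comp continuous_fst).mul continuous_const) continuous_snd))
    · ext p
      simp [hk0]
  · simp only [hTF i j hF]
    exact (hT.disjoint i j hij).preimage _

end Covers

end GradientCovers

/-! ### The gradient flow -/

namespace GradientCovers

/-- The critical points are the fixed points of the time `1` map, so they form a compact set. -/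
theorem IsLyapunov.finite_crit {n : ℕ} {M : Type*} [TopologicalSpace M] [T2Space M]
    [CompactSpace M] [ChartedSpace (EuclideanSpace ℝ (Fin n)) M] {F f : M → ℝ} {φ : Flow ℝ M}
    (hφ : IsLyapunov φ F (Subtype.val : Crit n f → M))
    (hiso : ∀ x ∈ Crit n f, ∀ᶠ y in 𝓝[≠] x, y ∉ Crit n f) : (Crit n f).Finite := by
  have heq : Crit n f = {p | φ 1 p = p} := by
    ext p
    refine ⟨fun hp => hφ.fixed ⟨p, hp⟩ 1, fun hp => ?_⟩
    by_contra hpc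
    have := hφ.lt p (by simpa using hpc) 1 one_pos
    rw [show φ 1 p = p from hp] at this
    exact lt_irrefl _ this
  have hcl : IsClosed (Crit n f) := by
    rw [heq]
    exact isClosed_eq (φ.continuous_toFun 1) continuous_id
  refine hcl.isCompact.finite (isDiscrete_iff_nhdsNE.2 fun p hp => ?_)
  rw [← disjoint_iff, Filter.disjoint_principal_right]
  exact hiso p hp

section Gradient

variable {n : ℕ} {M : Type*} [TopologicalSpace M]
  [ChartedSpace (EuclideanSpace ℝ (Fin n)) M] [IsManifold (𝓡 n) ∞ M]
  {g : SmoothMetric n M} {f : M → ℝ}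

theorem contMDiff_neg_grad (g : SmoothMetric n M) (hf : ContMDiff (𝓡 n) 𝓘(ℝ, ℝ) 2 f) :
    ContMDiff (𝓡 n) (𝓡 n).tangent 1
      (fun p => (⟨p, -grad g f p⟩ : TangentBundle (𝓡 n) M)) :=
  ContMDiff.neg_section (contMDiff_grad g hf)

theorem IsGradientTrajectory.eq [T2Space M] (hf : ContMDiff (𝓡 n) 𝓘(ℝ, ℝ) 2 f) {γ γ' : ℝ → M}
    (hγ : IsGradientTrajectory g f γ) (hγ' : IsGradientTrajectory g f γ') (h : γ 0 = γ' 0) :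
    γ = γ' := by
  have : IsManifold (𝓡 n) 1 M := .of_le (n := ∞) (by norm_cast)
  exact isMIntegralCurve_eq_of_contMDiff (t₀ := 0) (fun _ => BoundarylessManifold.isInteriorPoint)
    (contMDiff_neg_grad g hf) hγ hγ' h

theorem IsGradientTrajectory.hasDerivAt (hf : ContMDiff (𝓡 n) 𝓘(ℝ, ℝ) 2 f) {γ : ℝ → M}
    (hγ : IsGradientTrajectory g f γ) (t : ℝ) :
    HasDerivAt (fun t => f (γ t)) (-g.inner (γ t) (grad g f (γ t)) (grad g f (γ t))) t := by
  have h1 : HasMFDerivAt 𝓘(ℝ, ℝ) 𝓘(ℝ, ℝ) (f ∘ γ) t _ :=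
    ((hf.mdifferentiable (by norm_num)) (γ t)).hasMFDerivAt.comp t (hγ t)
  have h2 : HasDerivAt (f ∘ γ) (mfderiv (𝓡 n) 𝓘(ℝ, ℝ) f (γ t) ((1 : ℝ) • -grad g f (γ t))) t :=
    HasFDerivAt.hasDerivAt (𝕜 := ℝ) (F := ℝ) h1.hasFDerivAt
  rw [one_smul, ContinuousLinearMap.map_neg, ← inner_grad] at h2
  exact h2

/-- Minus a function is a Lyapunov function of its downward gradient flow. -/
theorem isLyapunov_neg [T2Space M] {ι : Type*} {x : ι → M} {φ : Flow ℝ M}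
    (hf : ContMDiff (𝓡 n) 𝓘(ℝ, ℝ) 2 f)
    (hφ : ∀ p, IsGradientTrajectory g f (fun t => φ t p)) (hx : range x = Crit n f) :
    IsLyapunov φ (fun p => -f p) x := by
  have hfix : ∀ p ∈ Crit n f, ∀ t, φ t p = p := by
    intro p hp t
    have hc : IsGradientTrajectory g f (fun _ => p) :=
      isMIntegralCurve_const (by simpa using (grad_eq_zero_iff g f p).2 hp)
    exact congrFun ((hφ p).eq hf hc (by simp)) t
  refine ⟨hf.continuous.neg, fun i t => hfix _ (hx ▸ mem_range_self i) t, fun p hp t ht => ?_⟩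
  have hp' : ∀ s, grad g f (φ s p) ≠ 0 := by
    intro s hs
    have h1 := (grad_eq_zero_iff g f _).1 hs
    have h2 := hfix _ h1 (-s)
    rw [← φ.map_add, neg_add_cancel, φ.map_zero_apply] at h2
    exact hp (by rw [hx, h2]; exact h1)
  have hanti : StrictAnti fun s => f (φ s p) := by
    refine strictAnti_of_deriv_neg fun s => ?_
    rw [((hφ p).hasDerivAt hf s).deriv, neg_lt_zero]
    exact g.pos _ _ (hp' s)
  simpa using hanti ht

end Gradient

end GradientCovers

theorem mainTheorem2 {n : ℕ} {M : Type*} [TopologicalSpace M] [T2Space M] [CompactSpace M]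
    [ChartedSpace (EuclideanSpace ℝ (Fin n)) M] [IsManifold (𝓡 n) ∞ M]
    (g : GradientCovers.SmoothMetric n M) (f : M → ℝ)
    (hf : ContMDiff (𝓡 n) 𝓘(ℝ, ℝ) 2 f)
    (hiso : ∀ x ∈ GradientCovers.Crit n f, ∀ᶠ y in 𝓝[≠] x, y ∉ GradientCovers.Crit n f) :
    (GradientCovers.Crit n f).Finite ∧
    ∀ (l : ℕ) (x : Fin l → M), Function.Injective x → Set.range x = GradientCovers.Crit n f →
      -- thickenings of the unstable manifolds
      (∃ W : Fin l → Set M, (⋃ i, W i) = Set.univ ∧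
        (∀ i, IsOpen (W i) ∧ GradientCovers.unstableManifold g f (x i) ⊆ W i ∧
          GradientCovers.NullhomotopicTo (W i) (x i)) ∧
        ∀ i j, i ≠ j → f (x i) = f (x j) → Disjoint (W i) (W j)) ∧
      -- ambient nullhomotopic sets covering given compact parts of the unstable manifolds
      (∀ K : Fin l → Set M,
        (∀ i, IsCompact (K i) ∧ K i ⊆ GradientCovers.unstableManifold g f (x i)) →
        ∃ U : Fin l → Set M, (⋃ i, U i) = Set.univ ∧
          (∀ i, IsOpen (U i) ∧ K i ⊆ U i ∧
            GradientCovers.AmbientNullhomotopicTo n (U i) (x i)) ∧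
          ∀ i j, i ≠ j → f (x i) = f (x j) → Disjoint (U i) (U j)) ∧
      -- thickenings of the stable manifolds
      (∃ W : Fin l → Set M, (⋃ i, W i) = Set.univ ∧
        (∀ i, IsOpen (W i) ∧ GradientCovers.stableManifold g f (x i) ⊆ W i ∧
          GradientCovers.NullhomotopicTo (W i) (x i)) ∧
        ∀ i j, i ≠ j → f (x i) = f (x j) → Disjoint (W i) (W j)) ∧
      -- ambient nullhomotopic sets covering given compact parts of the stable manifolds
      (∀ K : Fin l → Set M,
        (∀ i, IsCompact (K i) ∧ K i ⊆ GradientCovers.stableManifold g f (x i)) →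
        ∃ U : Fin l → Set M, (⋃ i, U i) = Set.univ ∧
          (∀ i, IsOpen (U i) ∧ K i ⊆ U i ∧
            GradientCovers.AmbientNullhomotopicTo n (U i) (x i)) ∧
          ∀ i j, i ≠ j → f (x i) = f (x j) → Disjoint (U i) (U j)) := by
  have : IsManifold (𝓡 n) 1 M := .of_le (n := ∞) (by norm_cast)
  obtain ⟨φ, hφ, hφs⟩ := GradientCovers.exists_flow (GradientCovers.contMDiff_neg_grad g hf)
  refine ⟨GradientCovers.IsLyapunov.finite_crit
    (GradientCovers.isLyapunov_neg hf hφ Subtype.range_coe) hiso, fun l x hx hxr => ?_⟩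
  have h := GradientCovers.isLyapunov_neg hf hφ hxr
  have hs : ∀ i, ∀ p ∈ GradientCovers.stableManifold g f (x i),
      Tendsto (fun t => φ t p) atTop (𝓝 (x i)) := by
    rintro i p ⟨γ, hγ, rfl, hlim⟩
    rwa [GradientCovers.IsGradientTrajectory.eq hf (hφ (γ 0)) hγ (by simp)]
  have hu : ∀ i, ∀ p ∈ GradientCovers.unstableManifold g f (x i),
      Tendsto (fun t => φ t p) atBot (𝓝 (x i)) := by
    rintro i p ⟨γ, hγ, rfl, hlim⟩
    rwa [GradientCovers.IsGradientTrajectory.eq hf (hφ (γ 0)) hγ (by simp)]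
  -- one cover thickens both the stable and the unstable manifolds
  obtain ⟨W, hW, hWi, hWd⟩ := h.exists_nullhomotopic_cover n hx
  refine ⟨⟨W, hW, fun i => ⟨(hWi i).1, fun p hp => (hWi i).2.1 _ p (hu i p hp), (hWi i).2.2⟩,
      fun i j hij hF => hWd i j hij (congrArg Neg.neg hF)⟩, fun K hK => ?_,
    ⟨W, hW, fun i => ⟨(hWi i).1, fun p hp => (hWi i).2.1 _ p (hs i p hp), (hWi i).2.2⟩,
      fun i j hij hF => hWd i j hij (congrArg Neg.neg hF)⟩, fun K hK => ?_⟩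
  · obtain ⟨U, hU, hUi, hUd⟩ := h.reverse.exists_ambientNullhomotopic_cover hx
      (fun t => hφs (-t)) (fun i => (hK i).1)
      (fun i p hp => (hu i p ((hK i).2 hp)).comp tendsto_neg_atTop_atBot)
    exact ⟨U, hU, hUi, fun i j hij hF => hUd i j hij (by simpa using hF)⟩
  · obtain ⟨U, hU, hUi, hUd⟩ := h.exists_ambientNullhomotopic_cover hx hφs (fun i => (hK i).1)
      (fun i p hp => hs i p ((hK i).2 hp))
    exact ⟨U, hU, hUi, fun i j hij hF => hUd i j hij (congrArg Neg.neg hF)⟩
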